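/- Let $V \neq \{0\}$ be a complex Hausdorff locally convex space whose topology is given by its continuous Hilbert seminorms, i.e. every continuous seminorm on $V$ is dominated by a seminorm $\|v\|_\alpha = \sqrt{\langle v, v\rangle_\alpha}$, where $\langle\cdot,\cdot\rangle_\alpha$ is a continuous positive (semi-definite) Hermitian form on $V$, antilinear in the first argument. Let $\overline{\,\cdot\,} : V \to V$ be a continuous antilinear involution, and call a bilinear form $\Lambda$ on $V$ Hermitian if $\Lambda(v,w) = \overline{\Lambda(\overline{w},\overline{v})}$ for all $v, w \in V$. Let $\mathcal{T}^\bullet(V) = \bigoplus_{k \ge 0} V^{\otimes k}$ be the algebraic tensor algebra with the locally convex topology defined by the seminorms $\|X\|^\bullet_\alpha = \sqrt{\langle X, X\rangle^\bullet_\alpha}$, one for every continuous positive Hermitian form $\langle\cdot,\cdot\rangle_\alpha$ on $V$. Here $\langle\cdot,\cdot\rangle^\bullet_\alpha$ is the sesquilinear form for which tensors of different degrees are orthogonal and $$\langle x_1 \otimes \cdots \otimes x_k,\, y_1 \otimes \cdots \otimes y_k\rangle^\bullet_\alpha = k! \prod_{m=1}^k \langle x_m, y_m\rangle_\alpha .$$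 Let $\mathcal{S}^\bullet(V) \subseteq \mathcal{T}^\bullet(V)$ be the subspace of symmetric tensors with the subspace topology, i.e. the image of the linear symmetrisation operator $\mathscr{S}(x_1\otimes\cdots\otimes x_k) = \frac{1}{k!}\sum_{\sigma \in \mathfrak{S}_k} x_{\sigma(1)}\otimes\cdots\otimes x_{\sigma(k)}$. Let ${}^*$ be the antilinear map with $(x_1\otimes\cdots\otimes x_k)^* = \overline{x_k}\otimes\cdots\otimes\overline{x_1}$, restricted to $\mathcal{S}^\bullet(V)$. For a continuous bilinear form $\Lambda$ on $V$ define the star product on $\mathcal{S}^\bullet(V)$ by $$X \star_\Lambda Y = \sum_{t=0}^\infty \frac{1}{t!}\, \mu_\vee\big((P_\Lambda)^t (X \otimes Y)\big),$$ a sum with only finitely many non-zero terms, where $\mu_\vee(X\otimes Y) = \mathscr{S}(XY)$ with $XY$ the product in the tensor algebra, and $P_\Lambda$ is the linear operator on $\mathcal{T}^\bullet(V)\otimes\mathcal{T}^\bullet(V)$ given by $$P_\Lambda\big((x_1\otimes\cdots\otimes x_k)\otimes(y_1\otimes\cdots\otimes y_\ell)\big) = k\ell\,\Lambda(x_k,y_1)\,(x_1\otimes\cdots\otimes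 x_{k-1})\otimes(y_2\otimes\cdots\otimes y_\ell)$$ for $k, \ell \ge 1$, and by $0$ if $k = 0$ or $\ell = 0$. A linear functional $\omega$ on $\mathcal{S}^\bullet(V)$ is positive for $\star_\Lambda$ if $\omega(X^* \star_\Lambda X) \ge 0$ for all $X \in \mathcal{S}^\bullet(V)$. A bilinear form $b : V\times V\to\mathbb{C}$ is of Hilbert–Schmidt type if there is a continuous positive Hermitian form $\langle\cdot,\cdot\rangle_\alpha$ on $V$ such that $b(v,w) = 0$ whenever $\|v\|_\alpha = 0$ or $\|w\|_\alpha = 0$, and such that $\sum_{i,j=1}^d |b(e_i,e_j)|^2 \le 1$ for every finite tuple $(e_1,\dots,e_d)$ of vectors in $V$ that is orthonormal with respect to $\langle\cdot,\cdot\rangle_\alpha$. **Theorem.** Let $\Lambda$ be a continuous Hermitian bilinear form on $V$. There exists a non-zero continuous linear functional on $\mathcal{S}^\bullet(V)$ that is positive for $\star_\Lambda$ if and only if there exists a symmetric and Hermitian bilinear form $b$ of Hilbert–Schmidt type on $V$ such that $\Lambda(\overline{v},v) + b(\overline{v},v) \ge 0$ for all $v\in V$. In this case the continuous linear functionals on $\mathcal{S}^\bullet(V)$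 that are positive for $\star_\Lambda$ are point-separating, i.e. their common kernel is $\{0\}$. -/

import Mathlib

open scoped TensorProduct DirectSum ComplexOrder ComplexConjugate

namespace HilbertStar

noncomputable section

/-! ## Continuous positive Hermitian forms -/

/-- A continuous positive Hermitian form on `V`: sesquilinear (antilinear in the first argument),
Hermitian, positive semi-definite and (jointly) continuous.  The type of all of them plays the role
of the set `I_V`; through `PosHermForm.seminorm` it also indexes the set `P_V` of all continuous
Hilbert seminorms. -/
structure PosHermForm (V : Type*) [AddCommGroup V] [Module ℂ V] [TopologicalSpace V] where
  form : V →ₗ⋆[ℂ] V →ₗ[ℂ] ℂ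
  conj_symm : ∀ v w, conj (form v w) = form w v
  nonneg : ∀ v, 0 ≤ form v v
  cont : Continuous fun p : V × V => form p.1 p.2

instance posHermForm_nonempty {V : Type*} [AddCommGroup V] [Module ℂ V] [TopologicalSpace V] :
    Nonempty (PosHermForm V) :=
  ⟨⟨0, by simp, by simp, by simpa using continuous_const⟩⟩

/-- The Hilbert seminorm `‖v‖ = √⟨v, v⟩` of a semi-definite sesquilinear form. -/
def formSeminorm {E : Type*} [AddCommGroup E] [Module ℂ E] (B : E →ₗ⋆[ℂ] E →ₗ[ℂ] ℂ)
    (hsymm : ∀ v w, conj (B v w) = B w v) (hpos : ∀ v, 0 ≤ B v v) : Seminorm ℂ E :=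
  letI core : PreInnerProductSpace.Core ℂ E :=
    { inner := fun v w => B v w
      conj_inner_symm := fun v w => hsymm w v
      re_inner_nonneg := fun v => (Complex.nonneg_iff.mp (hpos v)).1
      add_left := fun x y z => by simp
      smul_left := fun x y r => by simp }
  letI : SeminormedAddCommGroup E := InnerProductSpace.Core.toSeminormedAddCommGroup (𝕜 := ℂ)
  Seminorm.of (fun v => √((B v v).re))
    (fun x y => norm_add_le x y)
    (fun a x => by
      have h : (starRingEnd ℂ) a * (a * B x x) = ((‖a‖ ^ 2 : ℝ) : ℂ) * B x x := by
        rw [← mul_assoc, mul_comm _ a, Complex.mul_conj, Complex.normSq_eq_norm_sq]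
      have h' : B (a • x) (a • x) = (starRingEnd ℂ) a * (a * B x x) := by
        simp [mul_left_comm]
      rw [h', h, Complex.re_ofReal_mul, Real.sqrt_mul (sq_nonneg ‖a‖),
        Real.sqrt_sq (norm_nonneg a)])

theorem formSeminorm_apply {E : Type*} [AddCommGroup E] [Module ℂ E] (B : E →ₗ⋆[ℂ] E →ₗ[ℂ] ℂ)
    (hsymm : ∀ v w, conj (B v w) = B w v) (hpos : ∀ v, 0 ≤ B v v) (v : E) :
    formSeminorm B hsymm hpos v = √((B v v).re) := rfl

/-- The continuous Hilbert seminorm belonging to a continuous positive Hermitian form. -/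
def PosHermForm.seminorm {V : Type*} [AddCommGroup V] [Module ℂ V] [TopologicalSpace V]
    (α : PosHermForm V) : Seminorm ℂ V :=
  formSeminorm α.form α.conj_symm α.nonneg

/-- The topology of the locally convex space `V` is given by its continuous Hilbert seminorms: these
are cofinal among all continuous seminorms. -/
def IsHilbertisable (V : Type*) [AddCommGroup V] [Module ℂ V] [TopologicalSpace V] : Prop :=
  ∀ p : Seminorm ℂ V, Continuous p → ∃ α : PosHermForm V, p ≤ α.seminorm

/-! ## Bilinear forms -/

section Forms

variable {V : Type*} [AddCommGroup V] [Module ℂ V] [TopologicalSpace V]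

/-- `Λ` equals its conjugate `Λ^*(v, w) = conj (Λ (w̄, v̄))`. -/
def IsHermitian (c : V →L⋆[ℂ] V) (Λ : V →ₗ[ℂ] V →ₗ[ℂ] ℂ) : Prop :=
  ∀ v w, Λ v w = conj (Λ (c w) (c v))

/-- Bilinear forms of Hilbert-Schmidt type. -/
def IsHilbertSchmidt (b : V →ₗ[ℂ] V →ₗ[ℂ] ℂ) : Prop :=
  ∃ α : PosHermForm V,
    (∀ v w, α.seminorm v = 0 ∨ α.seminorm w = 0 → b v w = 0) ∧
    ∀ (d : ℕ) (e : Fin d → V), (∀ i j, α.form (e i) (e j) = if i = j then 1 else 0) →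
      ∑ i, ∑ j, ‖b (e i) (e j)‖ ^ 2 ≤ 1

end Forms

/-! ## The tensor algebra -/

/-- The (algebraic) tensor algebra `⨁_k V^{⊗k}`; its multiplication is the tensor product. -/
abbrev TensorAlg (V : Type*) [AddCommGroup V] [Module ℂ V] : Type _ := ⨁ k : ℕ, ⨂[ℂ]^k V

section Algebraic

variable {V : Type*} [AddCommGroup V] [Module ℂ V]

/-- The homogeneous element `x` of degree `k`, as an element of the tensor algebra. -/
abbrev inDeg (k : ℕ) : ⨂[ℂ]^k V →ₗ[ℂ] TensorAlg V :=
  DirectSum.lof ℂ ℕ (fun k => ⨂[ℂ]^k V) k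

/-- The simple tensor `x_1 ⊗ ⋯ ⊗ x_k`, as an element of the tensor algebra. -/
abbrev simple {k : ℕ} (x : Fin k → V) : TensorAlg V := inDeg k (PiTensorProduct.tprod ℂ x)

theorem tensorAlg_induction {p : TensorAlg V → Prop} (X : TensorAlg V)
    (h0 : p 0) (hadd : ∀ X Y, p X → p Y → p (X + Y))
    (h : ∀ (r : ℂ) (k : ℕ) (x : Fin k → V), p (r • simple x)) : p X := by
  induction X using DirectSum.induction_on with
  | zero => exact h0
  | of k x =>
    induction x using PiTensorProduct.induction_on with
    | smul_tprod r f => have := h r k f; rwa [← map_smul] at this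
    | add x y hx hy => rw [map_add]; exact hadd _ _ hx hy
  | add x y hx hy => exact hadd _ _ hx hy

/-- The antilinear extension to `V^{⊗k}` of a map `φ` on `V^k` that is additive and antihomogeneous
in every variable. -/
def antiLift {k : ℕ} {E : Type*} [AddCommGroup E] [Module ℂ E] (φ : (Fin k → V) → E)
    (hadd : ∀ f i (x y : V), φ (Function.update f i (x + y)) =
      φ (Function.update f i x) + φ (Function.update f i y))
    (hsmul : ∀ f i (r : ℂ) (x : V), φ (Function.update f i (r • x)) =
      conj r • φ (Function.update f i x)) :
    ⨂[ℂ]^k V →ₗ⋆[ℂ] E :=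
  let F : ⨂[ℂ]^k V →+ E := PiTensorProduct.liftAddHom (fun p => conj p.1 • φ p.2)
    (fun r f i hi => by
      have h := hsmul f i 0 0
      have h' : Function.update f i (0 : V) = f := by rw [← hi, Function.update_eq_self]
      simp only [smul_zero, map_zero, zero_smul, h'] at h
      simp [h])
    (fun f => by simp)
    (fun {inst} r f i x y => by
      obtain rfl : inst = instDecidableEqFin k := Subsingleton.elim _ _
      simp only [hadd, smul_add])
    (fun r r' f => by simp [add_smul])
    (fun {inst} r f i r' => by
      obtain rfl : inst = instDecidableEqFin k := Subsingleton.elim _ _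
      simp only [hsmul, Function.update_eq_self, map_mul, mul_smul]
      rw [smul_comm])
  have hF : ∀ (r : ℂ) (f : Fin k → V), F (r • PiTensorProduct.tprod ℂ f) = conj r • φ f := by
    intro r f
    rw [← PiTensorProduct.tprodCoeff_eq_smul_tprod]
    rfl
  { F with
    map_smul' := fun r X => by
      induction X using PiTensorProduct.induction_on with
      | smul_tprod s f =>
        change F _ = _ • F _
        rw [smul_smul, hF, hF, map_mul, mul_smul]
      | add X Y hX hY =>
        change F _ = _ • F _ at hX
        change F _ = _ • F _ at hY
        change F _ = _ • F _
        rw [smul_add, map_add, map_add, smul_add, hX, hY] }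

theorem antiLift_tprod {k : ℕ} {E : Type*} [AddCommGroup E] [Module ℂ E] (φ : (Fin k → V) → E)
    (hadd) (hsmul) (f : Fin k → V) :
    antiLift φ hadd hsmul (PiTensorProduct.tprod ℂ f) = φ f := by
  have : antiLift φ hadd hsmul (PiTensorProduct.tprodCoeff ℂ 1 f) = conj (1 : ℂ) • φ f := rfl
  rw [PiTensorProduct.tprodCoeff_eq_smul_tprod] at this
  simpa using this

/-! ### Extension of sesquilinear forms -/

/-- The sesquilinear extension of `B` to `V^{⊗k}`, given by
`⟨x_1 ⊗ ⋯ ⊗ x_k, y_1 ⊗ ⋯ ⊗ y_k⟩ = k! ∏ B (x_m, y_m)`. -/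
def powForm (B : V →ₗ⋆[ℂ] V →ₗ[ℂ] ℂ) (k : ℕ) : ⨂[ℂ]^k V →ₗ⋆[ℂ] ⨂[ℂ]^k V →ₗ[ℂ] ℂ :=
  antiLift
    (fun x => (k.factorial : ℂ) • PiTensorProduct.lift
      ((MultilinearMap.mkPiAlgebra ℂ (Fin k) ℂ).compLinearMap fun m => B (x m)))
    (fun f i x y => by
      ext z
      simp only [LinearMap.compMultilinearMap_apply, LinearMap.smul_apply, LinearMap.add_apply,
        PiTensorProduct.lift.tprod, MultilinearMap.compLinearMap_apply,
        MultilinearMap.mkPiAlgebra_apply, ← smul_add]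
      congr 1
      rw [← Finset.mul_prod_erase _ _ (Finset.mem_univ i),
        ← Finset.mul_prod_erase _ _ (Finset.mem_univ i),
        ← Finset.mul_prod_erase _ _ (Finset.mem_univ i)]
      have h : ∀ v w : V, ∏ m ∈ Finset.univ.erase i, B (Function.update f i v m) (z m) =
          ∏ m ∈ Finset.univ.erase i, B (Function.update f i w m) (z m) := fun v w =>
        Finset.prod_congr rfl fun m hm => by
          rw [Function.update_of_ne (Finset.ne_of_mem_erase hm),
            Function.update_of_ne (Finset.ne_of_mem_erase hm)]
      rw [h (x + y) x, h y x]
      simp [add_mul])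
    (fun f i r x => by
      ext z
      simp only [LinearMap.compMultilinearMap_apply, LinearMap.smul_apply,
        PiTensorProduct.lift.tprod, MultilinearMap.compLinearMap_apply,
        MultilinearMap.mkPiAlgebra_apply]
      rw [smul_comm]
      congr 1
      rw [← Finset.mul_prod_erase _ _ (Finset.mem_univ i),
        ← Finset.mul_prod_erase _ _ (Finset.mem_univ i)]
      have h : ∏ m ∈ Finset.univ.erase i, B (Function.update f i (r • x) m) (z m) =
          ∏ m ∈ Finset.univ.erase i, B (Function.update f i x m) (z m) :=
        Finset.prod_congr rfl fun m hm => by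
          rw [Function.update_of_ne (Finset.ne_of_mem_erase hm),
            Function.update_of_ne (Finset.ne_of_mem_erase hm)]
      rw [h]
      simp [mul_assoc])

theorem powForm_tprod (B : V →ₗ⋆[ℂ] V →ₗ[ℂ] ℂ) {k : ℕ} (x y : Fin k → V) :
    powForm B k (PiTensorProduct.tprod ℂ x) (PiTensorProduct.tprod ℂ y) =
      k.factorial * ∏ m, B (x m) (y m) := by
  simp [powForm, antiLift_tprod]

/-- The sesquilinear extension `⟨X, Y⟩^• = ∑_k ⟨X_k, Y_k⟩^•` to the tensor algebra. -/
def tensorForm (B : V →ₗ⋆[ℂ] V →ₗ[ℂ] ℂ) : TensorAlg V →ₗ⋆[ℂ] TensorAlg V →ₗ[ℂ] ℂ where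
  toFun X := DirectSum.toModule ℂ ℕ ℂ fun k => powForm B k (X k)
  map_add' X Y := by ext; simp
  map_smul' r X := by ext; simp [DirectSum.smul_apply]

theorem tensorForm_apply (B : V →ₗ⋆[ℂ] V →ₗ[ℂ] ℂ) (X Y : TensorAlg V) :
    tensorForm B X Y = DirectSum.toModule ℂ ℕ ℂ (fun k => powForm B k (X k)) Y := rfl

open Classical in
theorem tensorForm_eq_sum (B : V →ₗ⋆[ℂ] V →ₗ[ℂ] ℂ) (X Y : TensorAlg V) :
    tensorForm B X Y = ∑ k ∈ DFinsupp.support Y, powForm B k (X k) (Y k) := by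
  rw [tensorForm_apply]
  conv_lhs => rw [← DirectSum.sum_support_of Y]
  rw [map_sum]
  refine Finset.sum_congr rfl fun k _ => ?_
  rw [← DirectSum.lof_eq_of ℂ]
  exact DirectSum.toModule_lof (M := fun k => ⨂[ℂ]^k V) ℂ k (Y k)

theorem powForm_conj_symm (B : V →ₗ⋆[ℂ] V →ₗ[ℂ] ℂ) (hsymm : ∀ v w, conj (B v w) = B w v) (k : ℕ)
    (X Y : ⨂[ℂ]^k V) : conj (powForm B k X Y) = powForm B k Y X := by
  induction X using PiTensorProduct.induction_on with
  | smul_tprod r x =>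
    induction Y using PiTensorProduct.induction_on with
    | smul_tprod s y =>
      simp only [map_smulₛₗ, LinearMap.smul_apply, powForm_tprod, smul_eq_mul, map_mul,
        Complex.conj_conj, map_prod, map_natCast, hsymm, RingHom.id_apply]
      ring
    | add Y Z hY hZ => simp only [map_add, LinearMap.add_apply, hY, hZ]
  | add X Z hX hZ => simp only [map_add, LinearMap.add_apply, hX, hZ]

open Classical in
theorem tensorForm_conj_symm (B : V →ₗ⋆[ℂ] V →ₗ[ℂ] ℂ) (hsymm : ∀ v w, conj (B v w) = B w v)
    (X Y : TensorAlg V) : conj (tensorForm B X Y) = tensorForm B Y X := by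
  have h : ∀ X Y : TensorAlg V, ∀ s : Finset ℕ, DFinsupp.support Y ⊆ s →
      tensorForm B X Y = ∑ k ∈ s, powForm B k (X k) (Y k) := by
    intro X Y s hs
    rw [tensorForm_eq_sum]
    refine Finset.sum_subset hs fun k _ hk => ?_
    rw [DFinsupp.notMem_support_iff] at hk
    rw [hk, map_zero]
  rw [h X Y (DFinsupp.support X ∪ DFinsupp.support Y) Finset.subset_union_right,
    h Y X (DFinsupp.support X ∪ DFinsupp.support Y) Finset.subset_union_left, map_sum]
  exact Finset.sum_congr rfl fun k _ => powForm_conj_symm B hsymm k _ _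

theorem prodForm_posSemidef (B : V →ₗ⋆[ℂ] V →ₗ[ℂ] ℂ) (hsymm : ∀ v w, conj (B v w) = B w v)
    (hpos : ∀ v, 0 ≤ B v v) {k : ℕ} (s : Finset (Fin k)) :
    (Matrix.of fun x y : Fin k → V => ∏ m ∈ s, B (x m) (y m)).PosSemidef := by
  classical
  have key : ∀ (c : (Fin k → V) →₀ ℂ) (g : (Fin k → V) → V),
      (c.sum fun i xi => c.sum fun j xj => star xi * B (g i) (g j) * xj) =
        B (c.sum fun i xi => xi • g i) (c.sum fun i xi => xi • g i) := by
    intro c g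
    simp only [Finsupp.sum, map_sum, LinearMap.sum_apply, map_smulₛₗ, LinearMap.smul_apply,
      smul_eq_mul, RingHom.id_apply, Finset.mul_sum]
    rw [Finset.sum_comm]
    refine Finset.sum_congr rfl fun i _ => Finset.sum_congr rfl fun j _ => ?_
    rw [starRingEnd_apply]
    ring
  induction s using Finset.induction_on with
  | empty =>
    refine ⟨by ext; simp, fun c => ?_⟩
    simp only [Finset.prod_empty, Matrix.of_apply, mul_one, Finsupp.sum, ← Finset.mul_sum,
      ← Finset.sum_mul, ← star_sum]
    exact star_mul_self_nonneg _
  | insert a s ha ih =>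
    have h1 : (Matrix.of fun x y : Fin k → V => B (x a) (y a)).PosSemidef := by
      refine ⟨by ext x y; simp [hsymm], fun c => ?_⟩
      simp only [Matrix.of_apply]
      rw [key c fun x => x a]
      exact hpos _
    have h2 : (Matrix.of fun x y : Fin k → V => ∏ m ∈ insert a s, B (x m) (y m)) =
        Matrix.hadamard (Matrix.of fun x y : Fin k → V => B (x a) (y a))
          (Matrix.of fun x y : Fin k → V => ∏ m ∈ s, B (x m) (y m)) := by
      ext x y
      simp [Finset.prod_insert ha]
    rw [h2]
    exact h1.hadamard ih

theorem powForm_nonneg (B : V →ₗ⋆[ℂ] V →ₗ[ℂ] ℂ) (hsymm : ∀ v w, conj (B v w) = B w v)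
    (hpos : ∀ v, 0 ≤ B v v) (k : ℕ) (X : ⨂[ℂ]^k V) : 0 ≤ powForm B k X X := by
  have hX : X ∈ Submodule.span ℂ (Set.range (PiTensorProduct.tprod ℂ (s := fun _ : Fin k => V))) := by
    rw [PiTensorProduct.span_tprod_eq_top]; trivial
  obtain ⟨c, rfl⟩ := Finsupp.mem_span_range_iff_exists_finsupp.mp hX
  have h := (prodForm_posSemidef B hsymm hpos (Finset.univ : Finset (Fin k))).2 c
  have h2 : (0 : ℂ) ≤ (k.factorial : ℂ) := by exact_mod_cast Nat.zero_le _
  convert mul_nonneg h2 h using 1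
  simp only [Finsupp.sum, map_sum, LinearMap.sum_apply, map_smulₛₗ, LinearMap.smul_apply,
    smul_eq_mul, RingHom.id_apply, powForm_tprod, Matrix.of_apply, Finset.mul_sum]
  rw [Finset.sum_comm]
  refine Finset.sum_congr rfl fun i _ => Finset.sum_congr rfl fun j _ => ?_
  rw [starRingEnd_apply]
  ring

theorem tensorForm_nonneg (B : V →ₗ⋆[ℂ] V →ₗ[ℂ] ℂ) (hsymm : ∀ v w, conj (B v w) = B w v)
    (hpos : ∀ v, 0 ≤ B v v) (X : TensorAlg V) : 0 ≤ tensorForm B X X := by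
  rw [tensorForm_eq_sum]
  exact Finset.sum_nonneg fun k _ => powForm_nonneg B hsymm hpos k _

/-! ### Symmetrisation -/

/-- The symmetrisation operator on `V^{⊗k}`:
`x_1 ⊗ ⋯ ⊗ x_k ↦ (1 / k!) ∑_σ x_{σ 1} ⊗ ⋯ ⊗ x_{σ k}`. -/
def powSym (k : ℕ) : ⨂[ℂ]^k V →ₗ[ℂ] ⨂[ℂ]^k V :=
  (k.factorial : ℂ)⁻¹ •
    ∑ σ : Equiv.Perm (Fin k), (PiTensorProduct.reindex ℂ (fun _ => V) σ.symm).toLinearMap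

theorem powSym_tprod {k : ℕ} (x : Fin k → V) :
    powSym k (PiTensorProduct.tprod ℂ x) =
      (k.factorial : ℂ)⁻¹ • ∑ σ : Equiv.Perm (Fin k), PiTensorProduct.tprod ℂ (fun i => x (σ i)) := by
  simp only [powSym, LinearMap.smul_apply, LinearMap.sum_apply, LinearEquiv.coe_coe]
  congr 1
  refine Finset.sum_congr rfl fun σ _ => ?_
  exact PiTensorProduct.reindex_tprod σ.symm x

/-- The symmetrisation operator on the tensor algebra. -/
def sym : TensorAlg V →ₗ[ℂ] TensorAlg V := DirectSum.lmap powSym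

variable (V) in
/-- The space of symmetric tensors, i.e. the image of the symmetrisation operator. -/
def symTensors : Submodule ℂ (TensorAlg V) := LinearMap.range sym

/-! ### The star product -/

/-- `μ_∨`: the tensor product, followed by symmetrisation. -/
def mulSym : TensorAlg V ⊗[ℂ] TensorAlg V →ₗ[ℂ] TensorAlg V :=
  sym ∘ₗ LinearMap.mul' ℂ (TensorAlg V)

/-- Splitting off the last factor: `x_1 ⊗ ⋯ ⊗ x_k ↦ k • (x_1 ⊗ ⋯ ⊗ x_{k-1}) ⊗ x_k` for `k ≥ 1`, and
zero on scalars. -/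
def splitLast : TensorAlg V →ₗ[ℂ] TensorAlg V ⊗[ℂ] V :=
  DirectSum.toModule ℂ ℕ _ fun k => match k with
    | 0 => 0
    | k + 1 => ((k + 1 : ℕ) : ℂ) • PiTensorProduct.lift (MultilinearMap.uncurryRight
        ((TensorProduct.mk ℂ (TensorAlg V) V ∘ₗ inDeg k).compMultilinearMap
          (PiTensorProduct.tprod ℂ)))

theorem splitLast_zero (x : Fin 0 → V) : splitLast (simple x) = 0 := by
  simp [splitLast, DirectSum.toModule_lof]

theorem splitLast_succ {k : ℕ} (x : Fin (k + 1) → V) :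
    splitLast (simple x) =
      ((k + 1 : ℕ) : ℂ) • (simple (fun i : Fin k => x i.castSucc) ⊗ₜ[ℂ] x (Fin.last k)) := by
  simp only [splitLast, DirectSum.toModule_lof, LinearMap.smul_apply, PiTensorProduct.lift.tprod]
  rfl

/-- Splitting off the first factor: `y_1 ⊗ ⋯ ⊗ y_l ↦ l • y_1 ⊗ (y_2 ⊗ ⋯ ⊗ y_l)` for `l ≥ 1`, and
zero on scalars. -/
def splitFirst : TensorAlg V →ₗ[ℂ] V ⊗[ℂ] TensorAlg V :=
  DirectSum.toModule ℂ ℕ _ fun l => match l with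
    | 0 => 0
    | l + 1 => ((l + 1 : ℕ) : ℂ) • PiTensorProduct.lift (LinearMap.uncurryLeft
        { toFun := fun v => (TensorProduct.mk ℂ V (TensorAlg V) v ∘ₗ inDeg l).compMultilinearMap
            (PiTensorProduct.tprod ℂ)
          map_add' := fun v w => by ext; simp
          map_smul' := fun r v => by ext; simp [TensorProduct.smul_tmul'] })

theorem splitFirst_zero (x : Fin 0 → V) : splitFirst (simple x) = 0 := by
  simp [splitFirst, DirectSum.toModule_lof]

theorem splitFirst_succ {l : ℕ} (y : Fin (l + 1) → V) :
    splitFirst (simple y) =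
      ((l + 1 : ℕ) : ℂ) • (y 0 ⊗ₜ[ℂ] simple (fun i : Fin l => y i.succ)) := by
  simp only [splitFirst, DirectSum.toModule_lof, LinearMap.smul_apply, PiTensorProduct.lift.tprod]
  rfl

/-- `(X ⊗ v) ⊗ (w ⊗ Y) ↦ Λ (v, w) • X ⊗ Y`. -/
def contract (Λ : V →ₗ[ℂ] V →ₗ[ℂ] ℂ) :
    (TensorAlg V ⊗[ℂ] V) ⊗[ℂ] (V ⊗[ℂ] TensorAlg V) →ₗ[ℂ] TensorAlg V ⊗[ℂ] TensorAlg V :=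
  TensorProduct.map
      ((TensorProduct.rid ℂ (TensorAlg V)).toLinearMap)
      (LinearMap.id) ∘ₗ
    (TensorProduct.map
      (LinearMap.lTensor (TensorAlg V) (TensorProduct.lift Λ)) LinearMap.id) ∘ₗ
    (TensorProduct.map (TensorProduct.assoc ℂ (TensorAlg V) V V).toLinearMap LinearMap.id) ∘ₗ
    (TensorProduct.assoc ℂ (TensorAlg V ⊗[ℂ] V) V (TensorAlg V)).symm.toLinearMap

theorem contract_tmul (Λ : V →ₗ[ℂ] V →ₗ[ℂ] ℂ) (X Y : TensorAlg V) (v w : V) :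
    contract Λ ((X ⊗ₜ v) ⊗ₜ (w ⊗ₜ Y)) = Λ v w • (X ⊗ₜ[ℂ] Y) := by
  simp [contract, TensorProduct.smul_tmul']

/-- The operator `P_Λ`, given on simple tensors of degrees `k, l ≥ 1` by
`(x_1 ⊗ ⋯ ⊗ x_k) ⊗ (y_1 ⊗ ⋯ ⊗ y_l) ↦
  k l Λ (x_k, y_1) • (x_1 ⊗ ⋯ ⊗ x_{k-1}) ⊗ (y_2 ⊗ ⋯ ⊗ y_l)`,
and zero if `k = 0` or `l = 0`. -/
def poisson (Λ : V →ₗ[ℂ] V →ₗ[ℂ] ℂ) :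
    TensorAlg V ⊗[ℂ] TensorAlg V →ₗ[ℂ] TensorAlg V ⊗[ℂ] TensorAlg V :=
  contract Λ ∘ₗ TensorProduct.map splitLast splitFirst

theorem poisson_zero_left (Λ : V →ₗ[ℂ] V →ₗ[ℂ] ℂ) (x : Fin 0 → V) (Y : TensorAlg V) :
    poisson Λ (simple x ⊗ₜ Y) = 0 := by
  rw [poisson, LinearMap.comp_apply, TensorProduct.map_tmul, splitLast_zero,
    TensorProduct.zero_tmul, map_zero]

theorem poisson_zero_right (Λ : V →ₗ[ℂ] V →ₗ[ℂ] ℂ) (X : TensorAlg V) (y : Fin 0 → V) :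
    poisson Λ (X ⊗ₜ simple y) = 0 := by
  rw [poisson, LinearMap.comp_apply, TensorProduct.map_tmul, splitFirst_zero,
    TensorProduct.tmul_zero, map_zero]

theorem poisson_succ (Λ : V →ₗ[ℂ] V →ₗ[ℂ] ℂ) {k l : ℕ} (x : Fin (k + 1) → V)
    (y : Fin (l + 1) → V) :
    poisson Λ (simple x ⊗ₜ simple y) =
      (((k + 1 : ℕ) : ℂ) * ((l + 1 : ℕ) : ℂ) * Λ (x (Fin.last k)) (y 0)) •
        (simple (fun i : Fin k => x i.castSucc) ⊗ₜ[ℂ] simple (fun i : Fin l => y i.succ)) := by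
  rw [poisson, LinearMap.comp_apply, TensorProduct.map_tmul, splitLast_succ, splitFirst_succ,
    TensorProduct.smul_tmul_smul, map_smul, contract_tmul, smul_smul]

theorem poisson_pow_simple (Λ : V →ₗ[ℂ] V →ₗ[ℂ] ℂ) (k : ℕ) : ∀ (t : ℕ), k < t →
    ∀ (x : Fin k → V) (l : ℕ) (y : Fin l → V), (poisson Λ ^ t) (simple x ⊗ₜ simple y) = 0 := by
  induction k with
  | zero =>
    intro t ht x l y
    obtain ⟨t, rfl⟩ := Nat.exists_eq_succ_of_ne_zero (Nat.ne_of_gt ht)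
    rw [Nat.succ_eq_add_one, pow_succ, Module.End.mul_apply, poisson_zero_left, map_zero]
  | succ k ih =>
    intro t ht x l y
    obtain ⟨t, rfl⟩ := Nat.exists_eq_succ_of_ne_zero (Nat.ne_of_gt (Nat.zero_lt_of_lt ht))
    rw [Nat.succ_eq_add_one, pow_succ, Module.End.mul_apply]
    cases l with
    | zero => rw [poisson_zero_right, map_zero]
    | succ l => rw [poisson_succ, map_smul, ih t (by omega), smul_zero]

/-- `P_Λ` is locally nilpotent. -/
theorem poisson_locally_nilpotent (Λ : V →ₗ[ℂ] V →ₗ[ℂ] ℂ) (Z : TensorAlg V ⊗[ℂ] TensorAlg V) :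
    ∃ N : ℕ, ∀ t, N ≤ t → (poisson Λ ^ t) Z = 0 := by
  have hadd : ∀ Z W : TensorAlg V ⊗[ℂ] TensorAlg V,
      (∃ N : ℕ, ∀ t, N ≤ t → (poisson Λ ^ t) Z = 0) →
      (∃ N : ℕ, ∀ t, N ≤ t → (poisson Λ ^ t) W = 0) →
      ∃ N : ℕ, ∀ t, N ≤ t → (poisson Λ ^ t) (Z + W) = 0 := by
    rintro Z W ⟨N, hN⟩ ⟨M, hM⟩
    refine ⟨max N M, fun t ht => ?_⟩
    rw [map_add, hN t (le_trans (le_max_left _ _) ht), hM t (le_trans (le_max_right _ _) ht),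
      add_zero]
  induction Z using TensorProduct.induction_on with
  | zero => exact ⟨0, fun t _ => map_zero _⟩
  | add Z W hZ hW => exact hadd Z W hZ hW
  | tmul X Y =>
    induction X using tensorAlg_induction with
    | h0 => exact ⟨0, fun t _ => by rw [TensorProduct.zero_tmul, map_zero]⟩
    | hadd X X' h h' => rw [TensorProduct.add_tmul]; exact hadd _ _ h h'
    | h r k x =>
      induction Y using tensorAlg_induction with
      | h0 => exact ⟨0, fun t _ => by rw [TensorProduct.tmul_zero, map_zero]⟩
      | hadd Y Y' h h' => rw [TensorProduct.tmul_add]; exact hadd _ _ h h'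
      | h s l y =>
        refine ⟨k + 1, fun t ht => ?_⟩
        rw [TensorProduct.smul_tmul_smul, map_smul, poisson_pow_simple Λ k t ht x l y, smul_zero]

/-- The summands of the star product. -/
abbrev starTerm (Λ : V →ₗ[ℂ] V →ₗ[ℂ] ℂ) (t : ℕ) : TensorAlg V ⊗[ℂ] TensorAlg V →ₗ[ℂ] TensorAlg V :=
  (t.factorial : ℂ)⁻¹ • (mulSym ∘ₗ poisson Λ ^ t)

/-- Only finitely many summands of the star product are different from zero. -/
theorem starTerm_finite (Λ : V →ₗ[ℂ] V →ₗ[ℂ] ℂ) (Z : TensorAlg V ⊗[ℂ] TensorAlg V) :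
    (Function.support fun t => starTerm Λ t Z).Finite := by
  obtain ⟨N, hN⟩ := poisson_locally_nilpotent Λ Z
  refine (Set.finite_lt_nat N).subset fun t ht => ?_
  by_contra h
  exact ht (by simp [starTerm, hN t (not_lt.mp h)])

/-- The map `μ_{⋆Λ} (Z) = ∑_t (1 / t!) μ_∨ (P_Λ^t Z)`; the sum is finite by `starTerm_finite`. -/
def mulStar (Λ : V →ₗ[ℂ] V →ₗ[ℂ] ℂ) : TensorAlg V ⊗[ℂ] TensorAlg V →ₗ[ℂ] TensorAlg V where
  toFun Z := ∑ᶠ t : ℕ, starTerm Λ t Z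
  map_add' Z W := by
    simp only [map_add]
    exact finsum_add_distrib (starTerm_finite Λ Z) (starTerm_finite Λ W)
  map_smul' r Z := by
    simp only [map_smul, RingHom.id_apply]
    exact (smul_finsum' r (starTerm_finite Λ Z)).symm

theorem mulStar_mem (Λ : V →ₗ[ℂ] V →ₗ[ℂ] ℂ) (Z : TensorAlg V ⊗[ℂ] TensorAlg V) :
    mulStar Λ Z ∈ symTensors V :=
  finsum_induction (fun X => X ∈ symTensors V) (Submodule.zero_mem _)
    (fun _ _ h h' => Submodule.add_mem _ h h')
    (fun _ => Submodule.smul_mem _ _ (LinearMap.mem_range_self sym _))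

/-- The star product `X ⋆_Λ Y` of symmetric tensors. -/
def starProd (Λ : V →ₗ[ℂ] V →ₗ[ℂ] ℂ) : symTensors V →ₗ[ℂ] symTensors V →ₗ[ℂ] symTensors V :=
  LinearMap.compr₂
    ((TensorProduct.mk ℂ (TensorAlg V) (TensorAlg V)).compl₁₂
      (symTensors V).subtype (symTensors V).subtype)
    ((mulStar Λ).codRestrict (symTensors V) (mulStar_mem Λ))

theorem starProd_coe (Λ : V →ₗ[ℂ] V →ₗ[ℂ] ℂ) (X Y : symTensors V) :
    (starProd Λ X Y : TensorAlg V) =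
      ∑ᶠ t : ℕ, (t.factorial : ℂ)⁻¹ •
        mulSym ((poisson Λ ^ t) ((X : TensorAlg V) ⊗ₜ[ℂ] (Y : TensorAlg V))) := rfl

/-! ### The involution -/

/-- The antilinear map `(x_1 ⊗ ⋯ ⊗ x_k)^* = x̄_k ⊗ ⋯ ⊗ x̄_1` on `V^{⊗k}`. -/
def powStar (c : V →ₗ⋆[ℂ] V) (k : ℕ) : ⨂[ℂ]^k V →ₗ⋆[ℂ] ⨂[ℂ]^k V :=
  antiLift (fun x => PiTensorProduct.tprod ℂ fun i => c (x i.rev))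
    (fun f i x y => by
      have h : ∀ v, (fun j : Fin k => c (Function.update f i v j.rev)) =
          Function.update (fun j : Fin k => c (f j.rev)) i.rev (c v) := by
        intro v; ext j
        by_cases hj : j = i.rev
        · subst hj; simp
        · rw [Function.update_of_ne hj,
            Function.update_of_ne fun h => hj (by rw [← h, Fin.rev_rev])]
      simp only [h, map_add, MultilinearMap.map_update_add])
    (fun f i r x => by
      have h : ∀ v, (fun j : Fin k => c (Function.update f i v j.rev)) =
          Function.update (fun j : Fin k => c (f j.rev)) i.rev (c v) := by
        intro v; ext j
        by_cases hj : j = i.rev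
        · subst hj; simp
        · rw [Function.update_of_ne hj,
            Function.update_of_ne fun h => hj (by rw [← h, Fin.rev_rev])]
      simp only [h, map_smulₛₗ, MultilinearMap.map_update_smul])

theorem powStar_tprod (c : V →ₗ⋆[ℂ] V) {k : ℕ} (x : Fin k → V) :
    powStar c k (PiTensorProduct.tprod ℂ x) = PiTensorProduct.tprod ℂ fun i => c (x i.rev) :=
  antiLift_tprod _ _ _ x

/-- The antilinear map `X ↦ X^*` on the tensor algebra. -/
def tensorStar (c : V →ₗ⋆[ℂ] V) : TensorAlg V →ₗ⋆[ℂ] TensorAlg V where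
  toFun := DirectSum.map fun k => (powStar c k).toAddMonoidHom
  map_add' X Y := map_add _ X Y
  map_smul' r X := by
    ext k : 1
    simp [DirectSum.map_apply, DirectSum.smul_apply]

theorem tensorStar_apply (c : V →ₗ⋆[ℂ] V) (X : TensorAlg V) (k : ℕ) :
    tensorStar c X k = powStar c k (X k) := rfl

theorem powStar_powSym (c : V →ₗ⋆[ℂ] V) (k : ℕ) (X : ⨂[ℂ]^k V) :
    powStar c k (powSym k X) = powSym k (powStar c k X) := by
  induction X using PiTensorProduct.induction_on with
  | smul_tprod r x =>
    simp only [map_smul, map_smulₛₗ, powSym_tprod, powStar_tprod, map_sum, map_inv₀, map_natCast]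
    congr 2
    refine Fintype.sum_equiv (Equiv.permCongr Fin.revPerm) _ _ fun σ => ?_
    congr 1
    ext i
    change _ = c (x (Fin.rev (Fin.rev (σ (Fin.rev i)))))
    rw [Fin.rev_rev]
  | add X Y hX hY => simp only [map_add, hX, hY]

theorem tensorStar_mem (c : V →ₗ⋆[ℂ] V) {X : TensorAlg V} (hX : X ∈ symTensors V) :
    tensorStar c X ∈ symTensors V := by
  obtain ⟨Y, rfl⟩ := hX
  refine ⟨tensorStar c Y, ?_⟩
  ext k : 1
  simp only [sym, DirectSum.lmap_apply, tensorStar_apply, powStar_powSym]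

/-- The antilinear map `X ↦ X^*` on symmetric tensors. -/
def symStar (c : V →ₗ⋆[ℂ] V) (X : symTensors V) : symTensors V :=
  ⟨tensorStar c X, tensorStar_mem c X.2⟩

end Algebraic

/-! ## The topology and continuous positive functionals -/

section Topological

variable {V : Type*} [AddCommGroup V] [Module ℂ V] [TopologicalSpace V]

/-- The extension `‖X‖^• = √⟨X, X⟩^•` of a continuous Hilbert seminorm to the tensor algebra. -/
def tensorSeminorm (α : PosHermForm V) : Seminorm ℂ (TensorAlg V) :=
  formSeminorm (tensorForm α.form) (tensorForm_conj_symm α.form α.conj_symm)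
    (tensorForm_nonneg α.form α.conj_symm α.nonneg)

variable (V) in
/-- The family of the extensions of all continuous Hilbert seminorms. -/
def tensorSeminormFamily : SeminormFamily ℂ (TensorAlg V) (PosHermForm V) := tensorSeminorm

/-- The locally convex topology on the tensor algebra, defined by the extensions of all continuous
Hilbert seminorms on `V`; the symmetric tensors carry the subspace topology. -/
instance tensorAlgTopology : TopologicalSpace (TensorAlg V) :=
  (tensorSeminormFamily V).moduleFilterBasis.topology

theorem tensorAlg_withSeminorms : WithSeminorms (tensorSeminormFamily V) := ⟨rfl⟩

/-- Positivity of a continuous linear functional on the symmetric tensors with respect to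
`⋆_Λ` and the involution: `ω (X^* ⋆_Λ X) ≥ 0` (in particular real) for all `X`. -/
def IsPositive (c : V →L⋆[ℂ] V) (Λ : V →ₗ[ℂ] V →ₗ[ℂ] ℂ) (ω : symTensors V →L[ℂ] ℂ) : Prop :=
  ∀ X : symTensors V, 0 ≤ ω (starProd Λ (symStar c.toLinearMap X) X)

end Topological

end

end HilbertStar

/-!
Write `c` for the conjugation, and let `ω ≠ 0` be continuous and positive. By Cauchy–Schwarz
`ω 1 > 0`, and `b(v, w) = ω(v ∨ w) / ω 1` is of Hilbert–Schmidt type because `ω` is continuous in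
degree two. For `v` of degree one, `v* ⋆ v = c v ∨ v + Λ(c v, v)`, so that
`Λ(c v, v) + b(c v, v) ≥ 0`.

Conversely, let `ω` be the Gaussian functional with covariance `b` and a Hermitian mean `ρ`, whose
value on the exponential series of `v` is `exp (ρ v + b(v, v) / 2)`. The Hilbert–Schmidt condition
makes `ω` continuous. On exponential series,
`ω((exp v)* ⋆ exp w) = conj (ω (exp v)) · exp (Λ(c v, w) + b(c v, w)) · ω (exp w)`, and this kernel
is positive by the Schur product theorem. In place of exponential series one works with the
divided powers `v^k / k!`, that is, with the coefficients of these identities.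

These functionals separate points: replace `ρ` by `s ρ` with `s` real. If `X` has degree `N`, the
coefficient of `s ^ N` in `ω X` is the value of `ρ^{⊗ N}` at the degree `N` part of `X`. The
Hermitian `ρ` span the dual, so by polarisation and Hahn–Banach that part vanishes.
-/

namespace HilbertStar

noncomputable section

section Polarization

theorem sum_neg_one_pow_card_smul_map_sum {R M N ι : Type*} [CommSemiring R] [AddCommMonoid M]
    [Module R M] [AddCommGroup N] [Module R N] [Fintype ι] [DecidableEq ι]
    (f : MultilinearMap R (fun _ : ι => M) N) (x : ι → M) :
    ∑ s : Finset ι, (-1 : ℤ) ^ s.card • f (fun _ => ∑ i ∈ sᶜ, x i) =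
      ∑ σ : Equiv.Perm ι, f fun i => x (σ i) := by
  have expand (s : Finset ι) : f (fun _ => ∑ i ∈ sᶜ, x i) =
      ∑ r : ι → ι, if s ∈ (Finset.univ.image r)ᶜ.powerset then f fun i => x (r i) else 0 := by
    rw [f.map_sum_finset (fun _ i => x i) fun _ => sᶜ, ← Finset.sum_filter]
    refine Finset.sum_congr (Finset.ext fun r => ?_) fun _ _ => rfl
    simp [Finset.subset_compl_comm (s := s), Finset.subset_iff]
  have sign_sum (r : ι → ι) :
      ∑ s ∈ (Finset.univ.image r)ᶜ.powerset, (-1 : ℤ) ^ s.card • f (fun i => x (r i)) =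
        if Function.Surjective r then f fun i => x (r i) else 0 := by
    have image_compl : (Finset.univ.image r)ᶜ = ∅ ↔ Function.Surjective r := by
      simp [Finset.compl_eq_empty_iff, Finset.eq_univ_iff_forall, Function.Surjective]
    rw [← Finset.sum_smul, Finset.sum_powerset_neg_one_pow_card, ite_smul, one_smul, zero_smul]
    simp only [image_compl]
  simp only [expand, Finset.smul_sum, smul_ite, smul_zero]
  rw [Finset.sum_comm]
  simp only [Finset.sum_ite_mem, Finset.univ_inter, sign_sum]
  refine (Fintype.sum_of_injective _ (DFunLike.coe_injective (F := Equiv.Perm ι))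
    (fun σ => f fun i => x (σ i)) _
    (fun r hr => if_neg fun h => hr ⟨.ofBijective r h.bijective_of_finite, rfl⟩)
    fun σ => (if_pos σ.surjective).symm).symm

end Polarization

section DividedPowers

variable {V : Type*} [AddCommGroup V] [Module ℂ V]

/-- The divided power `v^[k] = (1 / k!) v ⊗ ⋯ ⊗ v`. With this normalisation the binomial formula
and the star product of powers have no combinatorial coefficients. -/
def divPow (v : V) (k : ℕ) : TensorAlg V := (k.factorial : ℂ)⁻¹ • simple fun _ : Fin k => v

theorem simple_eq_one (x : Fin 0 → V) : simple x = 1 := by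
  rw [simple, DirectSum.lof_eq_of]
  exact congrArg (DirectSum.of _ 0) (congrArg _ (Subsingleton.elim _ _))

theorem divPow_zero (v : V) : divPow v 0 = 1 := by
  simp [divPow, simple_eq_one]

theorem sym_inDeg {k : ℕ} (T : ⨂[ℂ]^k V) : sym (inDeg k T) = inDeg k (powSym k T) :=
  DirectSum.lmap_lof (f := fun k => (powSym k : ⨂[ℂ]^k V →ₗ[ℂ] ⨂[ℂ]^k V)) k T

theorem sym_simple {k : ℕ} (x : Fin k → V) :
    sym (simple x) = (k.factorial : ℂ)⁻¹ • ∑ σ : Equiv.Perm (Fin k), simple fun i => x (σ i) := by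
  rw [sym_inDeg, powSym_tprod, map_smul, map_sum]

theorem sym_simple_comp_equiv {k l : ℕ} (e : Fin k ≃ Fin l) (x : Fin l → V) :
    sym (simple fun i => x (e i)) = sym (simple x) := by
  obtain rfl : k = l := by simpa using Fintype.card_congr e
  rw [sym_simple, sym_simple]
  exact congrArg _ (Fintype.sum_equiv (Equiv.mulLeft e) _ _ fun _ => rfl)

theorem sym_simple_const (v : V) (k : ℕ) :
    sym (simple fun _ : Fin k => v) = simple fun _ : Fin k => v := by
  rw [sym_simple, Finset.sum_const, Finset.card_univ, Fintype.card_perm, Fintype.card_fin,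
    ← Nat.cast_smul_eq_nsmul ℂ, inv_smul_smul₀ (Nat.cast_ne_zero.mpr k.factorial_ne_zero)]

theorem sym_divPow (v : V) (k : ℕ) : sym (divPow v k) = divPow v k := by
  rw [divPow, map_smul, sym_simple_const]

theorem divPow_mem_symTensors (v : V) (k : ℕ) : divPow v k ∈ symTensors V :=
  ⟨divPow v k, sym_divPow v k⟩

theorem sym_sym (X : TensorAlg V) : sym (sym X) = sym X := by
  induction X using tensorAlg_induction with
  | h0 => simp only [map_zero]
  | hadd X Y hX hY => simp only [map_add, hX, hY]
  | h r k x =>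
    have average :
        ∑ _σ : Equiv.Perm (Fin k), sym (simple x) = (k.factorial : ℂ) • sym (simple x) := by
      simp [Fintype.card_perm, Nat.cast_smul_eq_nsmul]
    rw [map_smul, map_smul]
    conv_lhs => rw [sym_simple x, map_smul, map_sum]
    simp only [sym_simple_comp_equiv, average]
    rw [inv_smul_smul₀ (Nat.cast_ne_zero.mpr k.factorial_ne_zero)]

theorem sym_of_mem {X : TensorAlg V} (hX : X ∈ symTensors V) : sym X = X := by
  obtain ⟨Y, rfl⟩ := hX
  exact sym_sym Y

theorem simple_mul_simple {k l : ℕ} (x : Fin k → V) (y : Fin l → V) :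
    simple x * simple y = simple (Fin.append x y) :=
  (DirectSum.of_mul_of (A := fun k => ⨂[ℂ]^k V) (PiTensorProduct.tprod ℂ x)
    (PiTensorProduct.tprod ℂ y)).trans (congrArg _ (TensorPower.tprod_mul_tprod ℂ x y))

theorem sym_simple_piecewise {n : ℕ} (s : Finset (Fin n)) (v w : V) :
    sym (simple (s.piecewise (fun _ => v) fun _ => w)) =
      sym (simple (fun _ : Fin s.card => v) * simple fun _ : Fin sᶜ.card => w) := by
  let e : Fin (s.card + sᶜ.card) ≃ Fin n :=
    finSumFinEquiv.symm.trans (finSumEquivOfFinset rfl rfl)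
  rw [simple_mul_simple, ← sym_simple_comp_equiv e]
  congr 2
  ext i
  refine Fin.addCases (fun j => ?_) (fun j => ?_) i
  · have : e (Fin.castAdd _ j) ∈ s := by simp [e]
    simp [this]
  · have : e (Fin.natAdd _ j) ∉ s := by
      simp only [e, Equiv.trans_apply, finSumFinEquiv_symm_apply_natAdd, finSumEquivOfFinset_inr]
      exact Finset.mem_compl.mp (Finset.orderEmbOfFin_mem _ _ _)
    simp [this]

theorem divPow_add (v w : V) (n : ℕ) :
    divPow (v + w) n =
      ∑ p ∈ Finset.HasAntidiagonal.antidiagonal n, sym (divPow v p.1 * divPow w p.2) := by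
  have expand : simple (fun _ : Fin n => v + w) = ∑ s : Finset (Fin n),
      sym (simple (fun _ : Fin s.card => v) * simple fun _ : Fin (n - s.card) => w) := by
    have multilinear : PiTensorProduct.tprod ℂ (fun _ : Fin n => v + w) = ∑ s : Finset (Fin n),
        PiTensorProduct.tprod ℂ (s.piecewise (fun _ => v) fun _ => w) :=
      MultilinearMap.map_add_univ _ _ _
    rw [← sym_simple_const, simple, multilinear, map_sum, map_sum]
    refine Finset.sum_congr rfl fun s _ => ?_
    rw [sym_simple_piecewise s v w, Finset.card_compl, Fintype.card_fin]
  rw [divPow, expand, ← Finset.powerset_univ, Finset.sum_powerset_apply_card fun m =>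
      sym (simple (fun _ : Fin m => v) * simple fun _ : Fin (n - m) => w),
    Finset.Nat.sum_antidiagonal_eq_sum_range_succ fun p q => sym (divPow v p * divPow w q),
    Finset.card_univ, Fintype.card_fin, Finset.smul_sum]
  refine Finset.sum_congr rfl fun m hm => ?_
  rw [divPow, divPow, smul_mul_smul_comm, map_smul, ← Nat.cast_smul_eq_nsmul ℂ, smul_smul,
    Nat.cast_choose ℂ (Finset.mem_range_succ_iff.mp hm)]
  congr 1
  field_simp [Nat.factorial_ne_zero]

theorem divPow_smul (z : ℂ) (v : V) (k : ℕ) : divPow (z • v) k = z ^ k • divPow v k := by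
  have : PiTensorProduct.tprod ℂ (fun _ : Fin k => z • v) =
      z ^ k • PiTensorProduct.tprod ℂ fun _ : Fin k => v := by
    rw [MultilinearMap.map_smul_univ, Finset.prod_const, Finset.card_univ, Fintype.card_fin]
  rw [divPow, divPow, simple, this, map_smul, smul_comm]

theorem symTensors_eq_span :
    symTensors V = Submodule.span ℂ (Set.range fun p : V × ℕ => divPow p.1 p.2) := by
  refine le_antisymm ?_ (Submodule.span_le.mpr ?_)
  · rintro _ ⟨X, rfl⟩
    induction X using tensorAlg_induction with
    | h0 => simp only [map_zero, Submodule.zero_mem]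
    | hadd X Y hX hY => rw [map_add]; exact Submodule.add_mem _ hX hY
    | h r k x =>
      have polarization := sum_neg_one_pow_card_smul_map_sum
        ((inDeg k).compMultilinearMap (PiTensorProduct.tprod ℂ (s := fun _ : Fin k => V))) x
      simp only [LinearMap.compMultilinearMap_apply] at polarization
      rw [map_smul, sym_simple, ← polarization, Finset.smul_sum]
      refine Submodule.smul_mem _ _ (Submodule.sum_mem _ fun s _ => ?_)
      rw [smul_comm]
      exact zsmul_mem (Submodule.subset_span (Set.mem_range_self (_, k))) _
  · rintro _ ⟨p, rfl⟩
    exact divPow_mem_symTensors _ _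

theorem exists_eq_sum_divPow (X : symTensors V) :
    ∃ (n : ℕ) (a : Fin n → ℂ) (v : Fin n → V) (k : Fin n → ℕ),
      (X : TensorAlg V) = ∑ i, a i • divPow (v i) (k i) := by
  obtain ⟨n, a, g, hX⟩ := Submodule.mem_span_set'.mp (symTensors_eq_span.le X.2)
  choose p hp using fun i => (g i).2
  exact ⟨n, a, fun i => (p i).1, fun i => (p i).2, by simp only [← hX, ← hp]⟩

end DividedPowers

section StarProduct

variable {V : Type*} [AddCommGroup V] [Module ℂ V]

theorem poisson_divPow_succ (Λ : V →ₗ[ℂ] V →ₗ[ℂ] ℂ) (v w : V) (k l : ℕ) :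
    poisson Λ (divPow v (k + 1) ⊗ₜ divPow w (l + 1)) = Λ v w • (divPow v k ⊗ₜ divPow w l) := by
  simp only [divPow, TensorProduct.smul_tmul_smul, map_smul, poisson_succ, smul_smul,
    Nat.factorial_succ]
  congr 1
  push_cast
  field_simp [Nat.factorial_ne_zero, Nat.cast_add_one_ne_zero]

theorem poisson_pow_divPow_add (Λ : V →ₗ[ℂ] V →ₗ[ℂ] ℂ) (v w : V) (t k l : ℕ) :
    (poisson Λ ^ t) (divPow v (k + t) ⊗ₜ divPow w (l + t)) =
      Λ v w ^ t • (divPow v k ⊗ₜ divPow w l) := by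
  induction t with
  | zero => simp
  | succ t ih =>
    rw [pow_succ (poisson Λ), Module.End.mul_apply, ← add_assoc, ← add_assoc, poisson_divPow_succ,
      map_smul, ih, smul_smul, pow_succ']

theorem poisson_divPow_of_eq_zero (Λ : V →ₗ[ℂ] V →ₗ[ℂ] ℂ) (v w : V) {k l : ℕ}
    (h : k = 0 ∨ l = 0) : poisson Λ (divPow v k ⊗ₜ divPow w l) = 0 := by
  rw [divPow, divPow, TensorProduct.smul_tmul_smul, map_smul]
  rcases h with rfl | rfl
  · rw [poisson_zero_left, smul_zero]
  · rw [poisson_zero_right, smul_zero]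

theorem poisson_pow_divPow_eq_zero (Λ : V →ₗ[ℂ] V →ₗ[ℂ] ℂ) (v w : V) {t k l : ℕ}
    (h : min k l < t) : (poisson Λ ^ t) (divPow v k ⊗ₜ divPow w l) = 0 := by
  obtain ⟨m, rfl⟩ : ∃ m, t = m + 1 + min k l := ⟨t - 1 - min k l, by omega⟩
  have reduce := poisson_pow_divPow_add Λ v w (min k l) (k - min k l) (l - min k l)
  rw [Nat.sub_add_cancel (min_le_left k l), Nat.sub_add_cancel (min_le_right k l)] at reduce
  rw [pow_add, Module.End.mul_apply, reduce, map_smul, pow_succ, Module.End.mul_apply,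
    poisson_divPow_of_eq_zero Λ v w (by omega), map_zero, smul_zero]

theorem mulStar_divPow (Λ : V →ₗ[ℂ] V →ₗ[ℂ] ℂ) (v w : V) (k l : ℕ) :
    mulStar Λ (divPow v k ⊗ₜ divPow w l) = ∑ t ∈ Finset.range (min k l + 1),
      (Λ v w ^ t / t.factorial) • sym (divPow v (k - t) * divPow w (l - t)) := by
  change ∑ᶠ t : ℕ, starTerm Λ t _ = _
  rw [finsum_eq_sum_of_support_subset (s := Finset.range (min k l + 1))]
  · refine Finset.sum_congr rfl fun t ht => ?_
    have hk : t ≤ k := by simp only [Finset.mem_range] at ht; omega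
    have hl : t ≤ l := by simp only [Finset.mem_range] at ht; omega
    have contracted := poisson_pow_divPow_add Λ v w t (k - t) (l - t)
    rw [Nat.sub_add_cancel hk, Nat.sub_add_cancel hl] at contracted
    change (t.factorial : ℂ)⁻¹ • mulSym ((poisson Λ ^ t) _) = _
    rw [contracted, map_smul, smul_smul, div_eq_inv_mul]
    rfl
  · refine fun t ht => Finset.mem_coe.mpr (Finset.mem_range.mpr ?_)
    by_contra h
    refine ht ?_
    change (t.factorial : ℂ)⁻¹ • mulSym ((poisson Λ ^ t) _) = 0
    rw [poisson_pow_divPow_eq_zero Λ v w (by omega), map_zero, smul_zero]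

theorem tensorStar_simple (c : V →ₗ⋆[ℂ] V) {k : ℕ} (x : Fin k → V) :
    tensorStar c (simple x) = simple fun i => c (x i.rev) := by
  rw [simple, simple, ← powStar_tprod, DirectSum.lof_eq_of, DirectSum.lof_eq_of]
  exact DirectSum.map_of _ _ _

theorem tensorStar_divPow (c : V →ₗ⋆[ℂ] V) (v : V) (k : ℕ) :
    tensorStar c (divPow v k) = divPow (c v) k := by
  rw [divPow, map_smulₛₗ, tensorStar_simple, map_inv₀, map_natCast, divPow]

end StarProduct

section NonnegForms

variable {E : Type*} [AddCommGroup E] [Module ℂ E] {B : E →ₗ⋆[ℂ] E →ₗ[ℂ] ℂ}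

theorem conj_form_apply (hB : B.IsNonneg) (v w : E) : conj (B v w) = B w v := by
  have im_self (u : E) : (B u u).im = 0 := (Complex.nonneg_iff.mp (hB.nonneg u)).2.symm
  have im_add := im_self (v + w)
  have im_add_I := im_self (v + Complex.I • w)
  simp only [map_add, map_smul, map_smulₛₗ, LinearMap.add_apply, LinearMap.smul_apply, smul_eq_mul,
    Complex.add_im, Complex.add_re, Complex.mul_im, Complex.mul_re, Complex.conj_I,
    Complex.neg_im, Complex.neg_re, Complex.I_re, Complex.I_im, im_self] at im_add im_add_I
  apply Complex.ext
  · rw [Complex.conj_re]; linarith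
  · rw [Complex.conj_im]; linarith

theorem form_self_eq_re (hB : B.IsNonneg) (v : E) : B v v = ((B v v).re : ℂ) :=
  Complex.ext rfl (Complex.nonneg_iff.mp (hB.nonneg v)).2.symm

/-- A non-negative form as a semi-definite inner product, which makes the library's results on
semi-inner product spaces available for it. -/
abbrev preInnerCore (hB : B.IsNonneg) : PreInnerProductSpace.Core ℂ E where
  inner v w := B v w
  conj_inner_symm v w := conj_form_apply hB w v
  re_inner_nonneg v := (Complex.nonneg_iff.mp (hB.nonneg v)).1
  add_left x y z := by simp
  smul_left x y r := by simp

theorem norm_form_sq_le (hB : B.IsNonneg) (v w : E) :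
    ‖B v w‖ ^ 2 ≤ (B v v).re * (B w w).re := by
  let _ := preInnerCore hB
  have cauchy_schwarz : ‖B v w‖ * ‖B w v‖ ≤ (B v v).re * (B w w).re :=
    InnerProductSpace.Core.inner_mul_inner_self_le (𝕜 := ℂ) v w
  rwa [← conj_form_apply hB v w, Complex.norm_conj, ← sq] at cauchy_schwarz

theorem form_eq_zero_of_self_eq_zero (hB : B.IsNonneg) {v : E} (hv : B v v = 0) (w : E) :
    B v w = 0 := by
  have bound := norm_form_sq_le hB v w
  rw [hv, Complex.zero_re, zero_mul] at bound
  exact norm_eq_zero.mp (pow_eq_zero_iff two_ne_zero |>.mp (bound.antisymm (sq_nonneg _)))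

theorem form_sum_smul_self {ι : Type*} [Fintype ι] (B : E →ₗ⋆[ℂ] E →ₗ[ℂ] ℂ) (a : ι → ℂ)
    (x : ι → E) :
    B (∑ i, a i • x i) (∑ i, a i • x i) =
      star a ⬝ᵥ (Matrix.of fun i j => B (x i) (x j)).mulVec a := by
  simp only [map_sum, LinearMap.sum_apply, map_smulₛₗ, LinearMap.smul_apply, smul_eq_mul,
    RingHom.id_apply, dotProduct, Matrix.mulVec, Pi.star_apply, Matrix.of_apply, Finset.mul_sum]
  rw [Finset.sum_comm]
  exact Finset.sum_congr rfl fun i _ => Finset.sum_congr rfl fun j _ => by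
    rw [starRingEnd_apply]; ring

end NonnegForms

namespace PosHermForm

variable {V : Type*} [AddCommGroup V] [Module ℂ V] [TopologicalSpace V]

theorem isNonneg (α : PosHermForm V) : α.form.IsNonneg := ⟨α.nonneg⟩

theorem seminorm_eq_zero_iff (α : PosHermForm V) {v : V} :
    α.seminorm v = 0 ↔ α.form v v = 0 := by
  rw [seminorm, formSeminorm_apply, Real.sqrt_eq_zero (Complex.nonneg_iff.mp (α.nonneg v)).1,
    form_self_eq_re α.isNonneg v, Complex.ofReal_re, Complex.ofReal_eq_zero]

/-- The continuous positive Hermitian form given by a continuous non-negative form. -/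
def ofIsNonneg (B : V →ₗ⋆[ℂ] V →ₗ[ℂ] ℂ) (hB : B.IsNonneg)
    (hcont : Continuous fun p : V × V => B p.1 p.2) : PosHermForm V :=
  ⟨B, conj_form_apply hB, hB.nonneg, hcont⟩

/-- The sum of two continuous positive Hermitian forms. -/
def add (α β : PosHermForm V) : PosHermForm V :=
  ofIsNonneg (α.form + β.form) (α.isNonneg.add β.isNonneg) (α.cont.add β.cont)

theorem add_form (α β : PosHermForm V) : (α.add β).form = α.form + β.form := rfl

/-- A non-negative multiple of a continuous positive Hermitian form. -/
def scale (r : NNReal) (α : PosHermForm V) : PosHermForm V :=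
  ofIsNonneg ((r : ℂ) • α.form) (α.isNonneg.smul (by positivity)) (α.cont.const_smul (r : ℂ))

/-- The form `(v, w) ↦ conj (ρ v) ρ w` of rank one given by a continuous linear functional. -/
def ofFunctional (ρ : V →L[ℂ] ℂ) : PosHermForm V :=
  ofIsNonneg
    (LinearMap.mk₂'ₛₗ (starRingEnd ℂ) (RingHom.id ℂ) (fun v w => conj (ρ v) * ρ w)
      (by simp [add_mul]) (by simp [mul_assoc]) (by simp [mul_add]) (by simp [mul_left_comm]))
    ⟨fun v => star_mul_self_nonneg (ρ v)⟩
    ((Complex.continuous_conj.comp (ρ.continuous.comp continuous_fst)).mul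
      (ρ.continuous.comp continuous_snd))

theorem exists_forall_form_self_le (s : Finset (PosHermForm V)) :
    ∃ γ : PosHermForm V, ∀ α ∈ s, ∀ v, α.form v v ≤ γ.form v v := by
  classical
  induction s using Finset.induction_on with
  | empty => exact ⟨Classical.arbitrary _, by simp⟩
  | insert β s _ ih =>
    obtain ⟨γ, hγ⟩ := ih
    refine ⟨β.add γ, fun α hα v => ?_⟩
    rcases Finset.mem_insert.mp hα with rfl | h
    · exact le_add_of_nonneg_right (γ.nonneg v)
    · exact (hγ α h v).trans (le_add_of_nonneg_left (β.nonneg v))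

end PosHermForm

section Kernels

open scoped MatrixOrder Matrix

variable {ι κ : Type*}

theorem entrywise_prod_nonneg (s : Finset κ) {A : κ → Matrix ι ι ℂ} (hA : ∀ m, 0 ≤ A m) :
    0 ≤ Matrix.of fun i j => ∏ m ∈ s, A m i j := by
  classical
  induction s using Finset.induction_on with
  | empty =>
    refine Matrix.PosSemidef.nonneg ⟨by ext; simp, fun a => ?_⟩
    simp only [Finset.prod_empty, Matrix.of_apply, mul_one, Finsupp.sum, ← Finset.mul_sum,
      ← Finset.sum_mul, ← star_sum]
    exact star_mul_self_nonneg _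
  | insert m s hm ih =>
    simp only [Finset.prod_insert hm]
    exact ((Matrix.nonneg_iff_posSemidef.mp (hA m)).hadamard
      (Matrix.nonneg_iff_posSemidef.mp ih)).nonneg

theorem hadamard_le_hadamard {A A' C C' : Matrix ι ι ℂ} (hA : 0 ≤ A) (hAA' : A ≤ A')
    (hC : 0 ≤ C) (hCC' : C ≤ C') : A ⊙ C ≤ A' ⊙ C' := by
  have split : A' ⊙ C' - A ⊙ C = (A' - A) ⊙ C' + A ⊙ (C' - C) := by
    ext i j
    simp only [Matrix.sub_apply, Matrix.add_apply, Matrix.hadamard_apply]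
    ring
  rw [Matrix.le_iff, split]
  exact (Matrix.PosSemidef.hadamard hAA' (Matrix.nonneg_iff_posSemidef.mp (hC.trans hCC'))).add
    ((Matrix.nonneg_iff_posSemidef.mp hA).hadamard hCC')

theorem entrywise_prod_le_prod (s : Finset κ) {A A' : κ → Matrix ι ι ℂ} (hA : ∀ m, 0 ≤ A m)
    (hAA' : ∀ m, A m ≤ A' m) :
    (Matrix.of fun i j => ∏ m ∈ s, A m i j) ≤ Matrix.of fun i j => ∏ m ∈ s, A' m i j := by
  classical
  induction s using Finset.induction_on with
  | empty => simp only [Finset.prod_empty, le_refl]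
  | insert m s hm ih =>
    simp only [Finset.prod_insert hm]
    exact hadamard_le_hadamard (hA m) (hAA' m) (entrywise_prod_nonneg s hA) ih

theorem entrywise_pow_nonneg {A : Matrix ι ι ℂ} (hA : 0 ≤ A) (n : ℕ) :
    0 ≤ Matrix.of fun i j => A i j ^ n := by
  simpa using entrywise_prod_nonneg (Finset.range n) fun _ => hA

theorem dotProduct_mulVec_mono [Fintype ι] {A A' : Matrix ι ι ℂ} (h : A ≤ A') (a : ι → ℂ) :
    star a ⬝ᵥ A *ᵥ a ≤ star a ⬝ᵥ A' *ᵥ a := by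
  have := Matrix.PosSemidef.dotProduct_mulVec_nonneg h a
  rwa [Matrix.sub_mulVec, dotProduct_sub, sub_nonneg] at this

theorem dotProduct_vecMulVec_star_mulVec [Fintype ι] (f a : ι → ℂ) :
    star a ⬝ᵥ Matrix.vecMulVec (star f) f *ᵥ a = ((‖f ⬝ᵥ a‖ ^ 2 : ℝ) : ℂ) := by
  rw [Matrix.vecMulVec_mulVec, ← Complex.normSq_eq_norm_sq, Complex.normSq_eq_conj_mul_self,
    starRingEnd_apply, Matrix.star_dotProduct]
  simp [mul_comm]

variable {V : Type*} [AddCommGroup V] [Module ℂ V] {B B' : V →ₗ⋆[ℂ] V →ₗ[ℂ] ℂ}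

theorem gram_nonneg (hB : B.IsNonneg) (x : ι → V) :
    0 ≤ Matrix.of fun i j => B (x i) (x j) := by
  have := (prodForm_posSemidef B (conj_form_apply hB) hB.nonneg (k := 1) Finset.univ).submatrix
    fun i _ => x i
  simpa [Matrix.submatrix] using this.nonneg

theorem gram_mono (h : (B' - B).IsNonneg) (x : ι → V) :
    (Matrix.of fun i j => B (x i) (x j)) ≤ Matrix.of fun i j => B' (x i) (x j) :=
  Matrix.nonneg_iff_posSemidef.mp (gram_nonneg h x)

theorem exists_eq_sum_tprod {k : ℕ} (X : ⨂[ℂ]^k V) :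
    ∃ (n : ℕ) (a : Fin n → ℂ) (x : Fin n → Fin k → V),
      X = ∑ i, a i • PiTensorProduct.tprod ℂ (x i) := by
  have hX : X ∈ Submodule.span ℂ
      (Set.range (PiTensorProduct.tprod ℂ (s := fun _ : Fin k => V))) := by
    rw [PiTensorProduct.span_tprod_eq_top]
    exact Submodule.mem_top
  obtain ⟨n, a, g, rfl⟩ := Submodule.mem_span_set'.mp hX
  choose x hx using fun i => (g i).2
  exact ⟨n, a, x, by simp only [hx]⟩

theorem powForm_sum_smul_tprod (B : V →ₗ⋆[ℂ] V →ₗ[ℂ] ℂ) {k n : ℕ} (a : Fin n → ℂ)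
    (x : Fin n → Fin k → V) :
    powForm B k (∑ i, a i • PiTensorProduct.tprod ℂ (x i))
        (∑ i, a i • PiTensorProduct.tprod ℂ (x i)) =
      k.factorial * (star a ⬝ᵥ (Matrix.of fun i j => ∏ m, B (x i m) (x j m)) *ᵥ a) := by
  have scaled : (Matrix.of fun i j => powForm B k (PiTensorProduct.tprod ℂ (x i))
      (PiTensorProduct.tprod ℂ (x j))) =
        (k.factorial : ℂ) • Matrix.of fun i j => ∏ m, B (x i m) (x j m) := by
    ext i j
    exact powForm_tprod B (x i) (x j)
  rw [form_sum_smul_self, scaled, Matrix.smul_mulVec, dotProduct_smul, smul_eq_mul]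

theorem powForm_mono (hB : B.IsNonneg) (h : (B' - B).IsNonneg) (k : ℕ) (X : ⨂[ℂ]^k V) :
    powForm B k X X ≤ powForm B' k X X := by
  obtain ⟨n, a, x, rfl⟩ := exists_eq_sum_tprod X
  rw [powForm_sum_smul_tprod, powForm_sum_smul_tprod]
  refine mul_le_mul_of_nonneg_left (dotProduct_mulVec_mono ?_ a) (Nat.cast_nonneg _)
  exact entrywise_prod_le_prod Finset.univ (fun m => gram_nonneg hB fun i => x i m)
    fun m => gram_mono h fun i => x i m

theorem tensorForm_mono (hB : B.IsNonneg) (h : (B' - B).IsNonneg) (X : TensorAlg V) :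
    tensorForm B X X ≤ tensorForm B' X X := by
  rw [tensorForm_eq_sum, tensorForm_eq_sum]
  exact Finset.sum_le_sum fun k _ => powForm_mono hB h k _

theorem tensorForm_inDeg (B : V →ₗ⋆[ℂ] V →ₗ[ℂ] ℂ) {k : ℕ} (X Y : ⨂[ℂ]^k V) :
    tensorForm B (inDeg k X) (inDeg k Y) = powForm B k X Y := by
  rw [tensorForm_apply, inDeg, DirectSum.toModule_lof, DirectSum.lof_apply]

end Kernels

section Continuity

variable {V : Type*} [AddCommGroup V] [Module ℂ V] [TopologicalSpace V]

theorem tensorSeminorm_sq (α : PosHermForm V) (X : TensorAlg V) :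
    tensorSeminorm α X ^ 2 = (tensorForm α.form X X).re := by
  rw [tensorSeminorm, formSeminorm_apply, Real.sq_sqrt]
  exact (Complex.nonneg_iff.mp (tensorForm_nonneg _ α.conj_symm α.nonneg X)).1

theorem tensorSeminorm_mono {α β : PosHermForm V} (h : ∀ v, α.form v v ≤ β.form v v) :
    tensorSeminorm α ≤ tensorSeminorm β := fun X =>
  Real.sqrt_le_sqrt (Complex.le_def.mp
    (tensorForm_mono α.isNonneg ⟨fun v => sub_nonneg.mpr (h v)⟩ X)).1

theorem exists_norm_le_tensorSeminorm (ω : symTensors V →L[ℂ] ℂ) :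
    ∃ (γ : PosHermForm V) (C : ℝ), 0 ≤ C ∧ ∀ X, ‖ω X‖ ≤ C * tensorSeminorm γ X := by
  have hs := LinearMap.withSeminorms_induced (𝕜 := ℂ) (E := symTensors V) (F := TensorAlg V)
    (tensorAlg_withSeminorms (V := V)) (symTensors V).subtype
  obtain ⟨s, C, -, hC⟩ := Seminorm.bound_of_continuous hs
    ((normSeminorm ℂ ℂ).comp ω.toLinearMap) (continuous_norm.comp ω.continuous)
  obtain ⟨γ, hγ⟩ := PosHermForm.exists_forall_form_self_le s
  refine ⟨γ, C, C.2, fun X => (hC X).trans ?_⟩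
  rw [smul_apply, NNReal.smul_def, smul_eq_mul]
  refine mul_le_mul_of_nonneg_left ?_ C.2
  exact Seminorm.finset_sup_apply_le (apply_nonneg _ _) fun α hα => tensorSeminorm_mono (hγ α hα) _

end Continuity

section DegreeTwo

variable {V : Type*} [AddCommGroup V] [Module ℂ V]

/-- The inclusion of `V` into its tensor algebra as the tensors of degree one. -/
def degreeOne : V →ₗ[ℂ] TensorAlg V where
  toFun v := divPow v 1
  map_add' v w := by
    simp [divPow_add, Finset.Nat.antidiagonal_succ, divPow_zero, sym_divPow, add_comm]
  map_smul' z v := by simp [divPow_smul]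

/-- The symmetric tensor product `v ∨ w` of two vectors. -/
def symPair : V →ₗ[ℂ] V →ₗ[ℂ] symTensors V :=
  ((LinearMap.mul ℂ (TensorAlg V)).compl₁₂ degreeOne degreeOne).compr₂ sym.rangeRestrict

/-- The unit of the tensor algebra as a symmetric tensor. -/
def symOne : symTensors V := ⟨1, divPow_zero (0 : V) ▸ divPow_mem_symTensors 0 0⟩

theorem symPair_coe (v w : V) :
    (symPair v w : TensorAlg V) = (2 : ℂ)⁻¹ • (simple ![v, w] + simple ![w, v]) := by
  have mul_eq : divPow v 1 * divPow w 1 = simple ![v, w] := by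
    rw [divPow, divPow, Nat.factorial_one, Nat.cast_one, inv_one, one_smul, one_smul,
      simple_mul_simple]
    congr 2
    ext i
    fin_cases i <;> rfl
  have perm_sum (f : Equiv.Perm (Fin 2) → TensorAlg V) : ∑ σ, f σ = f 1 + f (Equiv.swap 0 1) := by
    rw [show (Finset.univ : Finset (Equiv.Perm (Fin 2))) = {1, Equiv.swap 0 1} by decide,
      Finset.sum_pair (by decide)]
  have swap_eq : (fun i => ![v, w] (Equiv.swap (0 : Fin 2) 1 i)) = ![w, v] := by
    ext i
    fin_cases i <;> rfl
  calc (symPair v w : TensorAlg V)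
    _ = sym (divPow v 1 * divPow w 1) := rfl
    _ = _ := by
      rw [mul_eq, sym_simple, perm_sum, swap_eq]
      rfl

theorem symPair_comm (v w : V) : symPair v w = symPair w v :=
  Subtype.ext (by rw [symPair_coe, symPair_coe, add_comm])

theorem symStar_symPair (c : V →ₗ⋆[ℂ] V) (v w : V) :
    symStar c (symPair v w) = symPair (c w) (c v) := by
  have star_pair (v w : V) : tensorStar c (simple ![v, w]) = simple ![c w, c v] := by
    rw [tensorStar_simple]
    congr 2
    ext i
    fin_cases i <;> rfl
  refine Subtype.ext ?_
  change tensorStar c (symPair v w : TensorAlg V) = _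
  rw [symPair_coe, symPair_coe, map_smulₛₗ, map_add, star_pair, star_pair, map_inv₀, map_ofNat]

theorem tensorForm_symPair (B : V →ₗ⋆[ℂ] V →ₗ[ℂ] ℂ) (v w v' w' : V) :
    tensorForm B (symPair v w : TensorAlg V) (symPair v' w' : TensorAlg V) =
      B v v' * B w w' + B v w' * B w v' := by
  have pair_form (v w v' w' : V) :
      tensorForm B (simple ![v, w]) (simple ![v', w']) = 2 * (B v v' * B w w') := by
    rw [simple, tensorForm_inDeg, powForm_tprod, Fin.prod_univ_two]
    simp [Nat.factorial]
  simp only [symPair_coe, map_smulₛₗ, map_add, LinearMap.smul_apply, LinearMap.add_apply,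
    pair_form, map_inv₀, map_ofNat, smul_eq_mul]
  ring

theorem starProd_symOne_left (Λ : V →ₗ[ℂ] V →ₗ[ℂ] ℂ) (X : symTensors V) :
    starProd Λ symOne X = X := by
  obtain ⟨n, a, v, k, hX⟩ := exists_eq_sum_divPow X
  refine Subtype.ext ?_
  change mulStar Λ (1 ⊗ₜ (X : TensorAlg V)) = X
  simp only [hX, TensorProduct.tmul_sum, TensorProduct.tmul_smul, map_sum, map_smul,
    ← divPow_zero (0 : V), mulStar_divPow, Nat.zero_min, zero_add, Finset.range_one,
    Finset.sum_singleton]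
  simp [divPow_zero, sym_divPow]

theorem starProd_symOne_right (Λ : V →ₗ[ℂ] V →ₗ[ℂ] ℂ) (X : symTensors V) :
    starProd Λ X symOne = X := by
  obtain ⟨n, a, v, k, hX⟩ := exists_eq_sum_divPow X
  refine Subtype.ext ?_
  change mulStar Λ ((X : TensorAlg V) ⊗ₜ 1) = X
  simp only [hX, TensorProduct.sum_tmul, ← TensorProduct.smul_tmul', map_sum, map_smul,
    ← divPow_zero (0 : V), mulStar_divPow, Nat.min_zero, zero_add, Finset.range_one,
    Finset.sum_singleton]
  simp [divPow_zero, sym_divPow]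

theorem starProd_degreeOne (Λ : V →ₗ[ℂ] V →ₗ[ℂ] ℂ) (v w : V) :
    starProd Λ ⟨divPow v 1, divPow_mem_symTensors v 1⟩ ⟨divPow w 1, divPow_mem_symTensors w 1⟩ =
      symPair v w + Λ v w • symOne := by
  refine Subtype.ext ?_
  change mulStar Λ (divPow v 1 ⊗ₜ divPow w 1) = sym (divPow v 1 * divPow w 1) + Λ v w • 1
  rw [mulStar_divPow, min_self, Finset.sum_range_succ, Finset.sum_range_one]
  simp [divPow_zero, sym_of_mem (X := 1) (symOne (V := V)).2]

theorem symStar_symOne (c : V →ₗ⋆[ℂ] V) : symStar c symOne = symOne := by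
  refine Subtype.ext ?_
  change tensorStar c 1 = 1
  rw [← divPow_zero (0 : V), tensorStar_divPow, divPow_zero, divPow_zero]

end DegreeTwo

section HilbertSchmidtOfFunctional

variable {V : Type*} [AddCommGroup V] [Module ℂ V]

theorem tensorForm_symPair_sum (B : V →ₗ⋆[ℂ] V →ₗ[ℂ] ℂ) {d : ℕ} {e : Fin d → V}
    (he : ∀ i j, B (e i) (e j) = if i = j then 1 else 0) {a : Fin d → Fin d → ℂ}
    (ha : ∀ i j, a i j = a j i) :
    tensorForm B (∑ i, ∑ j, a i j • symPair (e i) (e j) : symTensors V)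
      (∑ i, ∑ j, a i j • symPair (e i) (e j) : symTensors V) =
        (2 * ∑ i, ∑ j, ‖a i j‖ ^ 2 : ℝ) := by
  set T : symTensors V := ∑ i, ∑ j, a i j • symPair (e i) (e j)
  have coe_T : (T : TensorAlg V) = ∑ i, ∑ j, a i j • (symPair (e i) (e j) : TensorAlg V) := by
    simp only [T, AddSubmonoidClass.coe_finsetSum, Submodule.coe_smul]
  have pair_left (k l : Fin d) :
      tensorForm B (symPair (e k) (e l) : TensorAlg V) (T : TensorAlg V) = 2 * a k l := by
    simp only [coe_T, map_sum, map_smul, tensorForm_symPair, he, smul_eq_mul, mul_add, mul_ite,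
      mul_one, mul_zero, Finset.sum_add_distrib, Finset.sum_ite_irrel, Finset.sum_const_zero,
      Finset.sum_ite_eq, Finset.mem_univ, if_true]
    rw [ha l k, two_mul]
  have norm_sq (z : ℂ) : ((‖z‖ ^ 2 : ℝ) : ℂ) = conj z * z := by
    rw [← Complex.normSq_eq_conj_mul_self, Complex.normSq_eq_norm_sq]
  conv_lhs => enter [1]; rw [coe_T]
  simp only [map_sum, LinearMap.sum_apply, map_smulₛₗ, LinearMap.smul_apply, smul_eq_mul,
    pair_left, Complex.ofReal_mul, Complex.ofReal_ofNat, Complex.ofReal_sum, norm_sq,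
    Finset.mul_sum, mul_left_comm]

variable [TopologicalSpace V]

theorem isHilbertSchmidt_of_sum_le {b : V →ₗ[ℂ] V →ₗ[ℂ] ℂ} (γ : PosHermForm V) (R : NNReal)
    (hnull : ∀ v w, γ.seminorm v = 0 ∨ γ.seminorm w = 0 → b v w = 0)
    (hsum : ∀ (d : ℕ) (e : Fin d → V), (∀ i j, γ.form (e i) (e j) = if i = j then 1 else 0) →
      ∑ i, ∑ j, ‖b (e i) (e j)‖ ^ 2 ≤ R) : IsHilbertSchmidt b := by
  have scale_form (v w : V) : (γ.scale (R + 1)).form v w = (R + 1 : ℝ) * γ.form v w := by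
    change ((R + 1 : NNReal) : ℂ) * γ.form v w = _
    norm_cast
  have pos : (0 : ℝ) < R + 1 := by positivity
  refine ⟨γ.scale (R + 1), fun v w h => hnull v w ?_, fun d e he => ?_⟩
  · simpa only [PosHermForm.seminorm_eq_zero_iff, scale_form, mul_eq_zero,
      Complex.ofReal_eq_zero, pos.ne', false_or] using h
  · set r : ℝ := √(R + 1)
    have hr : (r : ℂ) * r = (R + 1 : ℝ) := by
      rw [← Complex.ofReal_mul, Real.mul_self_sqrt pos.le]
    have rescaled := hsum d (fun i => (r : ℂ) • e i) fun i j => by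
      rw [← he i j, scale_form, ← hr]
      simp only [map_smul, map_smulₛₗ, LinearMap.smul_apply, smul_eq_mul, Complex.conj_ofReal]
      ring
    have norm_smul_smul (i j : Fin d) : ‖b ((r : ℂ) • e i) ((r : ℂ) • e j)‖ ^ 2 =
        (R + 1) ^ 2 * ‖b (e i) (e j)‖ ^ 2 := by
      simp only [map_smul, LinearMap.smul_apply, smul_eq_mul]
      rw [← mul_assoc, hr, norm_mul, Complex.norm_real, Real.norm_of_nonneg pos.le, mul_pow]
    simp only [norm_smul_smul, ← Finset.mul_sum] at rescaled
    by_contra! large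
    nlinarith [R.2]

theorem isHilbertSchmidt_symPair {ω : symTensors V →ₗ[ℂ] ℂ} {γ : PosHermForm V} {C : ℝ}
    (hω : ∀ X, ‖ω X‖ ≤ C * tensorSeminorm γ X) : IsHilbertSchmidt (symPair.compr₂ ω) := by
  have bound (X : symTensors V) : ‖ω X‖ ^ 2 ≤ C ^ 2 * (tensorForm γ.form X X).re := by
    rw [← tensorSeminorm_sq, ← mul_pow]
    exact pow_le_pow_left₀ (norm_nonneg _) (hω X) 2
  have null_left {v : V} (hv : γ.seminorm v = 0) (w : V) : ω (symPair v w) = 0 := by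
    have zero_left := form_eq_zero_of_self_eq_zero γ.isNonneg (γ.seminorm_eq_zero_iff.mp hv)
    have := bound (symPair v w)
    rw [tensorForm_symPair, zero_left, zero_left, zero_mul, zero_mul, add_zero, Complex.zero_re,
      mul_zero] at this
    exact norm_eq_zero.mp (pow_eq_zero_iff two_ne_zero |>.mp (this.antisymm (sq_nonneg _)))
  refine isHilbertSchmidt_of_sum_le γ (2 * ‖C‖₊ ^ 2) (fun v w h => ?_) fun d e he => ?_
  · rcases h with h | h
    · exact null_left h w
    · exact (congrArg ω (symPair_comm v w)).trans (null_left h v)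
  · set a : Fin d → Fin d → ℂ := fun i j => conj (ω (symPair (e i) (e j)))
    set S := ∑ i, ∑ j, ‖ω (symPair (e i) (e j))‖ ^ 2
    have apply_sum : ω (∑ i, ∑ j, a i j • symPair (e i) (e j)) = (S : ℂ) := by
      simp only [map_sum, map_smul, smul_eq_mul, a, S, Complex.ofReal_sum,
        ← Complex.normSq_eq_conj_mul_self, Complex.normSq_eq_norm_sq]
    have key := bound (∑ i, ∑ j, a i j • symPair (e i) (e j))
    rw [tensorForm_symPair_sum _ he fun i j => by simp only [a, symPair_comm (e i)], apply_sum,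
      Complex.ofReal_re, Complex.norm_real, Real.norm_eq_abs, sq_abs] at key
    simp only [a, Complex.norm_conj] at key
    change S ≤ 2 * |C| ^ 2
    rw [sq_abs]
    by_contra! large
    nlinarith [sq_nonneg C]

end HilbertSchmidtOfFunctional

section PositiveFunctionals

variable {V : Type*} [AddCommGroup V] [Module ℂ V]

/-- The sesquilinear form `(X, Y) ↦ ω (X* ⋆ Y)` on symmetric tensors. -/
def starForm (c : V →ₗ⋆[ℂ] V) (Λ : V →ₗ[ℂ] V →ₗ[ℂ] ℂ) (ω : symTensors V →ₗ[ℂ] ℂ) :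
    symTensors V →ₗ⋆[ℂ] symTensors V →ₗ[ℂ] ℂ :=
  ((starProd Λ).compr₂ ω).comp
    { toFun := symStar c
      map_add' := fun X Y => Subtype.ext (map_add (tensorStar c) (X : TensorAlg V) Y)
      map_smul' := fun z X => Subtype.ext (map_smulₛₗ (tensorStar c) z (X : TensorAlg V)) }

theorem starForm_apply (c : V →ₗ⋆[ℂ] V) (Λ : V →ₗ[ℂ] V →ₗ[ℂ] ℂ) (ω : symTensors V →ₗ[ℂ] ℂ)
    (X Y : symTensors V) : starForm c Λ ω X Y = ω (starProd Λ (symStar c X) Y) := rfl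

variable [TopologicalSpace V] {c : V →L⋆[ℂ] V} {Λ : V →ₗ[ℂ] V →ₗ[ℂ] ℂ} {ω : symTensors V →L[ℂ] ℂ}

namespace IsPositive

theorem isNonneg (h : IsPositive c Λ ω) : (starForm c.toLinearMap Λ ω.toLinearMap).IsNonneg := ⟨h⟩

theorem map_symStar (h : IsPositive c Λ ω) (X : symTensors V) :
    ω (symStar c.toLinearMap X) = conj (ω X) := by
  have := conj_form_apply h.isNonneg symOne X
  rw [starForm_apply, starForm_apply, symStar_symOne, starProd_symOne_left,
    starProd_symOne_right] at this
  exact this.symm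

theorem map_symOne_pos (h : IsPositive c Λ ω) (hω : ω ≠ 0) : 0 < ω symOne := by
  have apply_one (X : symTensors V) : starForm c.toLinearMap Λ ω.toLinearMap symOne X = ω X := by
    rw [starForm_apply, symStar_symOne, starProd_symOne_left]
    rfl
  refine lt_of_le_of_ne (apply_one symOne ▸ h.isNonneg.nonneg symOne) fun one_eq => hω ?_
  ext X
  rw [← apply_one X]
  exact form_eq_zero_of_self_eq_zero h.isNonneg ((apply_one symOne).trans one_eq.symm) X

theorem exists_hilbertSchmidt (h : IsPositive c Λ ω) (hc : ∀ v, c (c v) = v) (hω : ω ≠ 0) :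
    ∃ b : V →ₗ[ℂ] V →ₗ[ℂ] ℂ, (∀ v w, b v w = b w v) ∧ IsHermitian c b ∧
      IsHilbertSchmidt b ∧ ∀ v, 0 ≤ Λ (c v) v + b (c v) v := by
  have one_pos := h.map_symOne_pos hω
  have one_real : conj (ω symOne) = ω symOne := by rw [← h.map_symStar, symStar_symOne]
  obtain ⟨γ, C, -, bound⟩ := exists_norm_le_tensorSeminorm ((ω symOne)⁻¹ • ω)
  have b_apply (v w : V) :
      symPair.compr₂ ((ω symOne)⁻¹ • ω).toLinearMap v w = (ω symOne)⁻¹ * ω (symPair v w) := rfl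
  refine ⟨symPair.compr₂ ((ω symOne)⁻¹ • ω).toLinearMap, fun v w => ?_, fun v w => ?_,
    isHilbertSchmidt_symPair bound, fun v => ?_⟩
  · rw [b_apply, b_apply, symPair_comm]
  · have star_pair : symStar c.toLinearMap (symPair (c w) (c v)) = symPair v w := by
      rw [symStar_symPair]
      change symPair (c (c v)) (c (c w)) = _
      rw [hc, hc]
    rw [b_apply, b_apply, map_mul, map_inv₀, one_real, ← h.map_symStar, star_pair]
  · have square := h ⟨divPow v 1, divPow_mem_symTensors v 1⟩
    have star_eq : symStar c.toLinearMap ⟨divPow v 1, divPow_mem_symTensors v 1⟩ =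
        ⟨divPow (c v) 1, divPow_mem_symTensors (c v) 1⟩ :=
      Subtype.ext (tensorStar_divPow c.toLinearMap v 1)
    rw [star_eq, starProd_degreeOne, map_add, map_smul, smul_eq_mul] at square
    rw [b_apply]
    convert mul_nonneg (inv_nonneg.mpr one_pos.le) square using 1
    rw [mul_add, mul_left_comm, inv_mul_cancel₀ one_pos.ne', mul_one, add_comm]

end IsPositive

end PositiveFunctionals

section Orthonormalization

theorem exists_orthonormal_of_seminormed {𝕜 E ι : Type*} [RCLike 𝕜] [SeminormedAddCommGroup E]
    [InnerProductSpace 𝕜 E] [Finite ι] (x : ι → E) :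
    ∃ (d : ℕ) (e : Fin d → E), Orthonormal 𝕜 e ∧
      ∀ i, ‖x i - ∑ k, inner 𝕜 (e k) (x i) • e k‖ = 0 := by
  let U := Submodule.span 𝕜 (Set.range fun i => SeparationQuotient.mk (x i))
  have : FiniteDimensional 𝕜 U := FiniteDimensional.span_of_finite 𝕜 (Set.finite_range _)
  let u := stdOrthonormalBasis 𝕜 U
  choose e he using fun k => SeparationQuotient.surjective_mk (u k : SeparationQuotient E)
  have inner_e (k : _) (v : E) :
      inner 𝕜 (e k) v = inner 𝕜 (u k : SeparationQuotient E) (SeparationQuotient.mk v) := by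
    rw [← he, SeparationQuotient.inner_mk_mk]
  refine ⟨_, e, orthonormal_iff_ite.mpr fun k l => ?_, fun i => ?_⟩
  · rw [inner_e, he, ← Submodule.coe_inner, orthonormal_iff_ite.mp u.orthonormal]
  · let w : U := ⟨SeparationQuotient.mk (x i), Submodule.subset_span ⟨i, rfl⟩⟩
    have expansion : ∑ k, inner 𝕜 (e k) (x i) • SeparationQuotient.mk (e k) =
        SeparationQuotient.mk (x i) := by
      simpa only [inner_e, he, Submodule.coe_sum, Submodule.coe_smul, Submodule.coe_inner]
        using congrArg Subtype.val (u.sum_repr' w)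
    rw [← SeparationQuotient.norm_mk, ← SeparationQuotient.mkCLM_apply 𝕜, map_sub, map_sum]
    simp only [map_smul, SeparationQuotient.mkCLM_apply, expansion, sub_self, norm_zero]

theorem exists_orthonormal_of_isNonneg {E ι : Type*} [AddCommGroup E] [Module ℂ E] [Finite ι]
    {B : E →ₗ⋆[ℂ] E →ₗ[ℂ] ℂ} (hB : B.IsNonneg) (x : ι → E) :
    ∃ (d : ℕ) (e : Fin d → E), (∀ k l, B (e k) (e l) = if k = l then 1 else 0) ∧
      ∀ i, B (x i - ∑ k, B (e k) (x i) • e k) (x i - ∑ k, B (e k) (x i) • e k) = 0 := by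
  let core := preInnerCore hB
  let _ : SeminormedAddCommGroup E := InnerProductSpace.Core.toSeminormedAddCommGroup (𝕜 := ℂ)
  let _ : InnerProductSpace ℂ E := InnerProductSpace.ofCore core
  obtain ⟨d, e, he, hx⟩ := exists_orthonormal_of_seminormed (𝕜 := ℂ) x
  refine ⟨d, e, orthonormal_iff_ite.mp he, fun i => ?_⟩
  have norm_sq := inner_self_eq_norm_sq_to_K (𝕜 := ℂ) (x i - ∑ k, B (e k) (x i) • e k)
  rw [show ‖x i - ∑ k, B (e k) (x i) • e k‖ = 0 from hx i] at norm_sq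
  exact norm_sq.trans (by simp)

end Orthonormalization

section HilbertSchmidtKernels

open scoped MatrixOrder Matrix

variable {ι : Type*} {V : Type*} [AddCommGroup V] [Module ℂ V] {B : V →ₗ⋆[ℂ] V →ₗ[ℂ] ℂ}
  {b : V →ₗ[ℂ] V →ₗ[ℂ] ℂ}

theorem vecMulVec_star_vecMul_le [Finite ι] {κ : Type*} [Fintype κ] {c : κ → ℂ}
    (hc : ∑ k, ‖c k‖ ^ 2 ≤ 1) (G : Matrix κ ι ℂ) :
    Matrix.vecMulVec (star (c ᵥ* G)) (c ᵥ* G) ≤ Gᴴ * G := by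
  cases nonempty_fintype ι
  refine Matrix.PosSemidef.of_dotProduct_mulVec_nonneg
    ((Matrix.isHermitian_conjTranspose_mul_self G).sub ?_) fun a => ?_
  · rw [Matrix.IsHermitian, Matrix.conjTranspose_vecMulVec, star_star]
  have gram : star a ⬝ᵥ (Gᴴ * G) *ᵥ a = ((∑ k, ‖(G *ᵥ a) k‖ ^ 2 : ℝ) : ℂ) := by
    rw [← Matrix.mulVec_mulVec, Matrix.dotProduct_mulVec, ← Matrix.star_mulVec]
    simp only [dotProduct, Pi.star_apply, Complex.ofReal_sum, ← Complex.normSq_eq_norm_sq,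
      Complex.normSq_eq_conj_mul_self, starRingEnd_apply]
  rw [Matrix.sub_mulVec, dotProduct_sub, sub_nonneg, dotProduct_vecMulVec_star_mulVec, gram,
    ← Matrix.dotProduct_mulVec, Complex.real_le_real]
  calc ‖c ⬝ᵥ G *ᵥ a‖ ^ 2 ≤ (∑ k, ‖c k‖ * ‖(G *ᵥ a) k‖) ^ 2 := by
        gcongr
        exact (norm_sum_le _ _).trans_eq (Finset.sum_congr rfl fun k _ => norm_mul _ _)
    _ ≤ (∑ k, ‖c k‖ ^ 2) * ∑ k, ‖(G *ᵥ a) k‖ ^ 2 := Finset.sum_mul_sq_le_sq_mul_sq _ _ _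
    _ ≤ ∑ k, ‖(G *ᵥ a) k‖ ^ 2 := mul_le_of_le_one_left (by positivity) hc

theorem form_apply_eq_sum_of_residual_null (hB : B.IsNonneg) {d : ℕ} (e : Fin d → V) {x : V}
    (hx : B (x - ∑ k, B (e k) x • e k) (x - ∑ k, B (e k) x • e k) = 0) (y : V) :
    B x y = ∑ k, conj (B (e k) x) * B (e k) y := by
  have residual := form_eq_zero_of_self_eq_zero hB hx y
  rw [map_sub, LinearMap.sub_apply, sub_eq_zero] at residual
  simpa using residual

theorem bilin_apply_eq_sum_of_residual_null
    (hb : ∀ v w, B v v = 0 ∨ B w w = 0 → b v w = 0) {d : ℕ} (e : Fin d → V) {x y : V}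
    (hx : B (x - ∑ k, B (e k) x • e k) (x - ∑ k, B (e k) x • e k) = 0)
    (hy : B (y - ∑ k, B (e k) y • e k) (y - ∑ k, B (e k) y • e k) = 0) :
    b x y = ∑ k, ∑ l, b (e k) (e l) * (B (e k) x * B (e l) y) := by
  have left := hb _ y (Or.inl hx)
  have right (k : Fin d) := hb (e k) _ (Or.inr hy)
  simp only [map_sub, LinearMap.sub_apply, sub_eq_zero] at left right
  rw [left]
  simp only [map_sum, map_smul, LinearMap.sum_apply, LinearMap.smul_apply, smul_eq_mul]
  refine Finset.sum_congr rfl fun k _ => ?_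
  rw [right k]
  simp only [map_sum, map_smul, smul_eq_mul, Finset.mul_sum]
  exact Finset.sum_congr rfl fun l _ => by ring

/-- The kernel form of the statement that `b` is a functional of norm at most one on the Hilbert
tensor square. -/
theorem vecMulVec_star_le_of_hilbertSchmidt [Finite ι] (hB : B.IsNonneg)
    (hb : ∀ v w, B v v = 0 ∨ B w w = 0 → b v w = 0)
    (hb_sum : ∀ (d : ℕ) (e : Fin d → V), (∀ i j, B (e i) (e j) = if i = j then 1 else 0) →
      ∑ i, ∑ j, ‖b (e i) (e j)‖ ^ 2 ≤ 1) (x y : ι → V) :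
    Matrix.vecMulVec (star fun i => b (x i) (y i)) (fun i => b (x i) (y i)) ≤
      Matrix.of fun i j => B (x i) (x j) * B (y i) (y j) := by
  cases nonempty_fintype ι
  obtain ⟨d, e, he, residual⟩ := exists_orthonormal_of_isNonneg hB (Sum.elim x y)
  have expand_x (i : ι) := form_apply_eq_sum_of_residual_null hB e (x := x i) (residual (.inl i))
  have expand_y (i : ι) := form_apply_eq_sum_of_residual_null hB e (x := y i) (residual (.inr i))
  have expand_b (i : ι) := bilin_apply_eq_sum_of_residual_null hb e (x := x i) (y := y i)
    (residual (.inl i)) (residual (.inr i))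
  let c : Fin d × Fin d → ℂ := fun k => b (e k.1) (e k.2)
  let G : Matrix (Fin d × Fin d) ι ℂ := Matrix.of fun k i => B (e k.1) (x i) * B (e k.2) (y i)
  have hc : ∑ k, ‖c k‖ ^ 2 ≤ 1 := (Fintype.sum_prod_type _).trans_le (hb_sum d e he)
  have hcG : c ᵥ* G = fun i => b (x i) (y i) := funext fun i =>
    (Fintype.sum_prod_type _).trans (expand_b i).symm
  have hGG : Gᴴ * G = Matrix.of fun i j => B (x i) (x j) * B (y i) (y j) := by
    ext i j
    rw [Matrix.of_apply, expand_x, expand_y, Finset.sum_mul_sum, Matrix.mul_apply,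
      Fintype.sum_prod_type]
    refine Finset.sum_congr rfl fun k _ => Finset.sum_congr rfl fun l _ => ?_
    simp only [G, Matrix.conjTranspose_apply, Matrix.of_apply, star_mul', starRingEnd_apply]
    exact mul_mul_mul_comm _ _ _ _
  simpa only [hcG, hGG] using vecMulVec_star_vecMul_le hc G

end HilbertSchmidtKernels

section PairForm

variable {V : Type*} [AddCommGroup V] [Module ℂ V]

/-- The multilinear form `b ⊗ ⋯ ⊗ b ⊗ ρ ⊗ ⋯ ⊗ ρ` in `n` variables with `j` factors `b`; it is set
to zero if `n < 2 j`. -/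
def pairForm (b : V →ₗ[ℂ] V →ₗ[ℂ] ℂ) (ρ : V →ₗ[ℂ] ℂ) :
    ∀ _ n : ℕ, MultilinearMap ℂ (fun _ : Fin n => V) ℂ
  | 0, n => (MultilinearMap.mkPiAlgebra ℂ (Fin n) ℂ).compLinearMap fun _ => ρ
  | _ + 1, 0 => 0
  | _ + 1, 1 => 0
  | j + 1, n + 2 => LinearMap.uncurryLeft
      { toFun := fun v => LinearMap.uncurryLeft ((b v).smulRight (pairForm b ρ j n))
        map_add' := fun v w => by ext; simp [add_mul]
        map_smul' := fun r v => by ext; simp [mul_assoc] }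

variable (b : V →ₗ[ℂ] V →ₗ[ℂ] ℂ) (ρ : V →ₗ[ℂ] ℂ)

theorem pairForm_zero (n : ℕ) (x : Fin n → V) : pairForm b ρ 0 n x = ∏ i, ρ (x i) := by
  simp [pairForm]

theorem pairForm_succ (j n : ℕ) (x : Fin (n + 2) → V) :
    pairForm b ρ (j + 1) (n + 2) x = b (x 0) (x 1) * pairForm b ρ j n fun i => x i.succ.succ := by
  simp only [pairForm]
  rfl

theorem pairForm_const (v : V) {j n : ℕ} (h : 2 * j ≤ n) :
    pairForm b ρ j n (fun _ => v) = b v v ^ j * ρ v ^ (n - 2 * j) := by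
  obtain ⟨p, rfl⟩ := Nat.exists_eq_add_of_le' h
  rw [Nat.add_sub_cancel]
  induction j with
  | zero => rw [pairForm_zero]; simp
  | succ j ih =>
    rw [show p + 2 * (j + 1) = p + 2 * j + 2 from rfl, pairForm_succ, ih (Nat.le_add_left _ _)]
    ring

open scoped MatrixOrder

theorem vecMulVec_star_pairForm_le {ι : Type*} [Finite ι] {B : V →ₗ⋆[ℂ] V →ₗ[ℂ] ℂ}
    (hB : B.IsNonneg)
    (hρ : ∀ x : ι → V, Matrix.vecMulVec (star fun i => ρ (x i)) (fun i => ρ (x i)) ≤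
      Matrix.of fun i j => B (x i) (x j))
    (hb : ∀ x y : ι → V, Matrix.vecMulVec (star fun i => b (x i) (y i))
      (fun i => b (x i) (y i)) ≤ Matrix.of fun i j => B (x i) (x j) * B (y i) (y j)) :
    ∀ (j n : ℕ) (x : ι → Fin n → V),
      Matrix.vecMulVec (star fun i => pairForm b ρ j n (x i)) (fun i => pairForm b ρ j n (x i)) ≤
        Matrix.of fun i k => ∏ m, B (x i m) (x k m)
  | 0, n, x => by
    have := entrywise_prod_le_prod Finset.univ
      (fun m => (Matrix.posSemidef_vecMulVec_star_self fun i => ρ (x i m)).nonneg)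
      fun m => hρ fun i => x i m
    convert this using 1
    · ext i k
      simp [pairForm_zero, Matrix.vecMulVec_apply, Finset.prod_mul_distrib]
    · rfl
  | j + 1, 0, x | j + 1, 1, x => by
    have := entrywise_prod_nonneg Finset.univ fun m => gram_nonneg hB fun i => x i m
    convert this using 1
    · ext i k
      simp [pairForm, Matrix.vecMulVec_apply]
    · rfl
  | j + 1, n + 2, x => by
    have tail := vecMulVec_star_pairForm_le hB hρ hb j n fun i m => x i m.succ.succ
    have := hadamard_le_hadamard (Matrix.posSemidef_vecMulVec_star_self _).nonneg
      (hb (fun i => x i 0) fun i => x i 1) (Matrix.posSemidef_vecMulVec_star_self _).nonneg tail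
    convert this using 1
    · ext i k
      simp only [pairForm_succ, Matrix.vecMulVec_apply, Matrix.hadamard_apply, Pi.star_apply,
        star_mul']
      ring
    · ext i k
      simp only [Fin.prod_univ_succ, Matrix.of_apply, Matrix.hadamard_apply, Fin.succ_zero_eq_one]
      ring

end PairForm

section GaussSeries

open PowerSeries

/-- The power series of `exp (c z ^ 2)`. -/
def expSq (c : ℂ) : ℂ⟦X⟧ := expand 2 two_ne_zero (rescale c (exp ℂ))

/-- The power series of `exp (a z + b z ^ 2 / 2)`, the moment generating function of a normal
distribution with mean `a` and variance `b`. -/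
def gaussSeries (a b : ℂ) : ℂ⟦X⟧ := expSq (b / 2) * rescale a (exp ℂ)

/-- The coefficient of `z ^ p w ^ q` in `G (z) H (w) exp (c z w)`. -/
def mixCoeff (G H : ℂ⟦X⟧) (c : ℂ) (p q : ℕ) : ℂ :=
  ∑ s ∈ Finset.range (min p q + 1), c ^ s / s.factorial * (coeff (p - s) G * coeff (q - s) H)

theorem coeff_rescale_exp (a : ℂ) (n : ℕ) : coeff n (rescale a (exp ℂ)) = a ^ n / n.factorial := by
  simp [coeff_rescale, coeff_exp, div_eq_mul_inv]

theorem coeff_expSq_mul (c : ℂ) (H : ℂ⟦X⟧) (n : ℕ) :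
    coeff n (expSq c * H) =
      ∑ r ∈ Finset.range (n / 2 + 1), c ^ r / r.factorial * coeff (n - 2 * r) H := by
  rw [coeff_mul, Finset.Nat.sum_antidiagonal_eq_sum_range_succ
    (fun i j => coeff i (expSq c) * coeff j H)]
  simp only [expSq, coeff_expand, coeff_rescale_exp, ite_mul, zero_mul]
  rw [← Finset.sum_filter]
  refine Finset.sum_nbij' (fun i => i / 2) (fun r => 2 * r) ?_ ?_ ?_ ?_ ?_
  all_goals intro i hi; simp only [Finset.mem_filter, Finset.mem_range] at hi ⊢
  · omega
  · omega
  · omega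
  · omega
  · rw [Nat.mul_div_cancel' hi.2]

theorem coeff_gaussSeries (a b : ℂ) (n : ℕ) :
    coeff n (gaussSeries a b) = ∑ j ∈ Finset.range (n / 2 + 1),
      (b / 2) ^ j / j.factorial * (a ^ (n - 2 * j) / (n - 2 * j).factorial) := by
  simp only [gaussSeries, coeff_expSq_mul, coeff_rescale_exp]

theorem gaussSeries_add (a b a' b' c : ℂ) :
    gaussSeries (a + a') (b + 2 * c + b') =
      expSq c * (gaussSeries a b * gaussSeries a' b') := by
  have expSq_add (d e : ℂ) : expSq (d + e) = expSq d * expSq e := by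
    rw [expSq, ← exp_mul_exp_eq_exp_add, map_mul, expSq, expSq]
  rw [gaussSeries, gaussSeries, gaussSeries, ← exp_mul_exp_eq_exp_add,
    show (b + 2 * c + b') / 2 = c + (b / 2 + b' / 2) by ring, expSq_add, expSq_add]
  ring

theorem rescale_gaussSeries (z a b : ℂ) :
    rescale z (gaussSeries a b) = gaussSeries (z * a) (z ^ 2 * b) := by
  ext n
  rw [coeff_rescale, coeff_gaussSeries, coeff_gaussSeries, Finset.mul_sum]
  refine Finset.sum_congr rfl fun j hj => ?_
  have hj' : 2 * j ≤ n := by rw [Finset.mem_range] at hj; omega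
  rw [mul_pow, mul_div_assoc, mul_pow, ← pow_mul, ← Nat.add_sub_of_le hj', pow_add,
    Nat.add_sub_cancel_left]
  ring

theorem conj_coeff_gaussSeries (a b : ℂ) (n : ℕ) :
    conj (coeff n (gaussSeries a b)) = coeff n (gaussSeries (conj a) (conj b)) := by
  simp [coeff_gaussSeries, Complex.conj_ofNat]

theorem sum_antidiagonal_pow_mul_mixCoeff (G H : ℂ⟦X⟧) (c z : ℂ) (n : ℕ) :
    ∑ p ∈ Finset.HasAntidiagonal.antidiagonal n, z ^ p.1 * mixCoeff G H c p.1 p.2 =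
      coeff n (expSq (z * c) * (rescale z G * H)) := by
  rw [coeff_expSq_mul]
  simp only [coeff_mul, mixCoeff, Finset.mul_sum]
  rw [Finset.sum_sigma', Finset.sum_sigma']
  refine Finset.sum_nbij' (fun x => ⟨x.2, x.1.1 - x.2, x.1.2 - x.2⟩)
    (fun y => ⟨(y.2.1 + y.1, y.2.2 + y.1), y.1⟩) ?_ ?_ ?_ ?_ ?_
  · rintro ⟨⟨p, q⟩, s⟩ h
    simp only [Finset.mem_sigma, Finset.HasAntidiagonal.mem_antidiagonal, Finset.mem_range] at h ⊢
    omega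
  · rintro ⟨r, i, j⟩ h
    simp only [Finset.mem_sigma, Finset.HasAntidiagonal.mem_antidiagonal, Finset.mem_range] at h ⊢
    omega
  · rintro ⟨⟨p, q⟩, s⟩ h
    have hs : s ≤ p ∧ s ≤ q := by simpa [Nat.lt_succ_iff] using (Finset.mem_sigma.mp h).2
    simp [Nat.sub_add_cancel hs.1, Nat.sub_add_cancel hs.2]
  · rintro ⟨r, i, j⟩ _
    simp
  · rintro ⟨⟨p, q⟩, s⟩ h
    have hs : s ≤ p ∧ s ≤ q := by simpa [Nat.lt_succ_iff] using (Finset.mem_sigma.mp h).2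
    obtain ⟨i, rfl⟩ := Nat.exists_eq_add_of_le' hs.1
    simp only [coeff_rescale, Nat.add_sub_cancel, pow_add, mul_pow]
    ring

theorem sum_antidiagonal_pow_div_factorial (a b : ℂ) (s : ℕ) :
    ∑ p ∈ Finset.HasAntidiagonal.antidiagonal s,
      a ^ p.1 / p.1.factorial * (b ^ p.2 / p.2.factorial) = (a + b) ^ s / s.factorial := by
  simp only [← coeff_rescale_exp, ← exp_mul_exp_eq_exp_add, coeff_mul]

theorem sum_pow_div_factorial_mul_mixCoeff (G H : ℂ⟦X⟧) (c d : ℂ) (k l : ℕ) :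
    ∑ t ∈ Finset.range (min k l + 1), d ^ t / t.factorial * mixCoeff G H c (k - t) (l - t) =
      mixCoeff G H (d + c) k l := by
  have shift (t : ℕ) (ht : t ∈ Finset.range (min k l + 1)) :
      d ^ t / t.factorial * mixCoeff G H c (k - t) (l - t) =
        ∑ r ∈ Finset.range (min k l + 1 - t), d ^ t / t.factorial * (c ^ r / r.factorial) *
          (coeff (k - (t + r)) G * coeff (l - (t + r)) H) := by
    rw [Finset.mem_range] at ht
    rw [mixCoeff, Finset.mul_sum, show min (k - t) (l - t) + 1 = min k l + 1 - t by omega]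
    simp only [Nat.sub_sub, mul_assoc]
  rw [Finset.sum_congr rfl shift, ← Finset.sum_range_diag_flip, mixCoeff]
  refine Finset.sum_congr rfl fun s _ => ?_
  rw [← Finset.Nat.sum_antidiagonal_eq_sum_range_succ fun t r =>
    d ^ t / t.factorial * (c ^ r / r.factorial) *
      (coeff (k - (t + r)) G * coeff (l - (t + r)) H),
    ← sum_antidiagonal_pow_div_factorial, Finset.sum_mul]
  refine Finset.sum_congr rfl fun p hp => ?_
  rw [Finset.HasAntidiagonal.mem_antidiagonal.mp hp]

theorem eq_of_sum_antidiagonal_pow_mul {n : ℕ} {f g : ℕ × ℕ → ℂ}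
    (h : ∀ z : ℂ, ∑ p ∈ Finset.HasAntidiagonal.antidiagonal n, z ^ p.1 * f p =
      ∑ p ∈ Finset.HasAntidiagonal.antidiagonal n, z ^ p.1 * g p) {p : ℕ × ℕ}
    (hp : p ∈ Finset.HasAntidiagonal.antidiagonal n) : f p = g p := by
  have as_range (f : ℕ × ℕ → ℂ) (z : ℂ) :
      ∑ p ∈ Finset.HasAntidiagonal.antidiagonal n, z ^ p.1 * f p =
        (∑ i ∈ Finset.range (n + 1), Polynomial.C (f (i, n - i)) * Polynomial.X ^ i).eval z := by
    rw [Finset.Nat.sum_antidiagonal_eq_sum_range_succ (fun i j => z ^ i * f (i, j))]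
    simp [Polynomial.eval_finsetSum, mul_comm (z ^ _)]
  simp only [as_range] at h
  have coeff_eq := congrArg (Polynomial.coeff · p.1) (Polynomial.funext h)
  rw [Finset.HasAntidiagonal.mem_antidiagonal] at hp
  have hp' : p.1 < n + 1 := by omega
  simpa [Polynomial.finsetSum_coeff, hp', show n - p.1 = p.2 by omega] using coeff_eq

end GaussSeries

section GaussFunctional

variable {V : Type*} [AddCommGroup V] [Module ℂ V] (b : V →ₗ[ℂ] V →ₗ[ℂ] ℂ) (ρ : V →ₗ[ℂ] ℂ)

/-- The degree `n` component of `gaussFunctional b ρ`. On a symmetric tensor, each of the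
`n.descFactorial (2 * j) / (2 ^ j * j!)` ways to choose `j` disjoint pairs of factors contributes
the same value, so that one representative `pairForm b ρ j n` suffices. -/
def gaussPow (n : ℕ) : (⨂[ℂ]^n V) →ₗ[ℂ] ℂ :=
  ∑ j ∈ Finset.range (n / 2 + 1),
    (n.descFactorial (2 * j) / (2 ^ j * j.factorial) : ℂ) • PiTensorProduct.lift (pairForm b ρ j n)

/-- The moment functional of the (formal, complex) Gaussian measure with mean `ρ` and covariance
`b`; it is meaningful on symmetric tensors, where it takes `exp v` to `exp (ρ v + b v v / 2)`. -/
def gaussFunctional : TensorAlg V →ₗ[ℂ] ℂ :=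
  DirectSum.toModule ℂ ℕ ℂ (gaussPow b ρ)

theorem gaussFunctional_inDeg (n : ℕ) (T : ⨂[ℂ]^n V) :
    gaussFunctional b ρ (inDeg n T) = gaussPow b ρ n T :=
  DirectSum.toModule_lof (M := fun k => ⨂[ℂ]^k V) ℂ n T

theorem gaussFunctional_divPow (v : V) (n : ℕ) :
    gaussFunctional b ρ (divPow v n) = PowerSeries.coeff n (gaussSeries (ρ v) (b v v)) := by
  rw [divPow, map_smul, simple, gaussFunctional_inDeg, gaussPow, LinearMap.sum_apply,
    coeff_gaussSeries, Finset.smul_sum]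
  refine Finset.sum_congr rfl fun j hj => ?_
  have hj' : 2 * j ≤ n := by rw [Finset.mem_range] at hj; omega
  have desc : ((n - 2 * j).factorial * n.descFactorial (2 * j) : ℂ) = n.factorial :=
    mod_cast Nat.factorial_mul_descFactorial hj'
  have := Nat.cast_ne_zero (R := ℂ).mpr n.factorial_ne_zero
  have := Nat.cast_ne_zero (R := ℂ).mpr (n - 2 * j).factorial_ne_zero
  rw [LinearMap.smul_apply, PiTensorProduct.lift.tprod, pairForm_const b ρ v hj', smul_eq_mul,
    smul_eq_mul, div_pow]
  field_simp
  linear_combination b v v ^ j * ρ v ^ (n - 2 * j) * desc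

variable {b}

theorem gaussFunctional_sym_divPow_mul_divPow (hb : ∀ v w, b v w = b w v) (v w : V) (p q : ℕ) :
    gaussFunctional b ρ (sym (divPow v p * divPow w q)) =
      mixCoeff (gaussSeries (ρ v) (b v v)) (gaussSeries (ρ w) (b w w)) (b v w) p q := by
  refine eq_of_sum_antidiagonal_pow_mul
    (f := fun p => gaussFunctional b ρ (sym (divPow v p.1 * divPow w p.2)))
    (g := fun p => mixCoeff (gaussSeries (ρ v) (b v v)) (gaussSeries (ρ w) (b w w)) (b v w) p.1 p.2)
    (p := (p, q)) (n := p + q) (fun z => ?_) (Finset.HasAntidiagonal.mem_antidiagonal.mpr rfl)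
  have variance_add : b (z • v + w) (z • v + w) = z ^ 2 * b v v + 2 * (z * b v w) + b w w := by
    simp only [map_add, map_smul, LinearMap.add_apply, LinearMap.smul_apply, smul_eq_mul, hb w v]
    ring
  have expand : gaussFunctional b ρ (divPow (z • v + w) (p + q)) =
      ∑ p ∈ Finset.HasAntidiagonal.antidiagonal (p + q),
        z ^ p.1 * gaussFunctional b ρ (sym (divPow v p.1 * divPow w p.2)) := by
    simp only [divPow_add, divPow_smul, smul_mul_assoc, map_sum, map_smul, smul_eq_mul]
  rw [← expand, sum_antidiagonal_pow_mul_mixCoeff, rescale_gaussSeries, ← gaussSeries_add,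
    ← variance_add, gaussFunctional_divPow, map_add, map_smul, smul_eq_mul]

theorem gaussFunctional_mulStar_divPow (hb : ∀ v w, b v w = b w v) (Λ : V →ₗ[ℂ] V →ₗ[ℂ] ℂ)
    (v w : V) (k l : ℕ) :
    gaussFunctional b ρ (mulStar Λ (divPow v k ⊗ₜ divPow w l)) =
      mixCoeff (gaussSeries (ρ v) (b v v)) (gaussSeries (ρ w) (b w w)) (Λ v w + b v w) k l := by
  simp only [mulStar_divPow, map_sum, map_smul, gaussFunctional_sym_divPow_mul_divPow ρ hb,
    smul_eq_mul, sum_pow_div_factorial_mul_mixCoeff]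

end GaussFunctional

section Bound

open scoped MatrixOrder Matrix

variable {V : Type*} [AddCommGroup V] [Module ℂ V] {B : V →ₗ⋆[ℂ] V →ₗ[ℂ] ℂ}

theorem factorial_mul_norm_lift_sq_le {n : ℕ} {M : MultilinearMap ℂ (fun _ : Fin n => V) ℂ}
    (hM : ∀ (d : ℕ) (x : Fin d → Fin n → V),
      Matrix.vecMulVec (star fun i => M (x i)) (fun i => M (x i)) ≤
        Matrix.of fun i j => ∏ m, B (x i m) (x j m))
    (T : ⨂[ℂ]^n V) :
    n.factorial * ‖PiTensorProduct.lift M T‖ ^ 2 ≤ (powForm B n T T).re := by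
  obtain ⟨d, a, x, rfl⟩ := exists_eq_sum_tprod T
  have lift_eq : PiTensorProduct.lift M (∑ i, a i • PiTensorProduct.tprod ℂ (x i)) =
      (fun i => M (x i)) ⬝ᵥ a := by
    simp only [map_sum, map_smul, PiTensorProduct.lift.tprod, smul_eq_mul, dotProduct, mul_comm]
  have kernel := dotProduct_mulVec_mono (hM d x) a
  rw [dotProduct_vecMulVec_star_mulVec, ← lift_eq] at kernel
  rw [powForm_sum_smul_tprod, ← Complex.ofReal_natCast, Complex.re_ofReal_mul]
  exact mul_le_mul_of_nonneg_left (Complex.le_def.mp kernel).1 (Nat.cast_nonneg _)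

theorem powForm_smul_self (B : V →ₗ⋆[ℂ] V →ₗ[ℂ] ℂ) (r : ℂ) (n : ℕ) (T : ⨂[ℂ]^n V) :
    powForm (r • B) n T T = r ^ n * powForm B n T T := by
  obtain ⟨d, a, x, rfl⟩ := exists_eq_sum_tprod T
  have scaled : (Matrix.of fun i j => ∏ m, (r • B) (x i m) (x j m)) =
      r ^ n • Matrix.of fun i j => ∏ m, B (x i m) (x j m) := by
    ext i j
    simp [Finset.prod_mul_distrib]
  rw [powForm_sum_smul_tprod, powForm_sum_smul_tprod, scaled, Matrix.smul_mulVec,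
    dotProduct_smul, smul_eq_mul, mul_left_comm]

theorem powForm_le_tensorForm (hB : B.IsNonneg) (X : TensorAlg V) (n : ℕ) :
    powForm B n (X n) (X n) ≤ tensorForm B X X := by
  classical
  have nonneg (k : ℕ) : 0 ≤ powForm B k (X k) (X k) :=
    powForm_nonneg B (conj_form_apply hB) hB.nonneg k _
  rw [tensorForm_eq_sum]
  by_cases hn : n ∈ DFinsupp.support X
  · exact Finset.single_le_sum (f := fun n => powForm B n (X n) (X n)) (fun k _ => nonneg k) hn
  · rw [DFinsupp.notMem_support_iff.mp hn, map_zero]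
    exact Finset.sum_nonneg fun k _ => nonneg k

theorem gaussFunctional_eq_sum (b : V →ₗ[ℂ] V →ₗ[ℂ] ℂ) (ρ : V →ₗ[ℂ] ℂ) {X : TensorAlg V}
    {s : Finset ℕ} (hs : ∀ n ∉ s, X n = 0) :
    gaussFunctional b ρ X = ∑ n ∈ s, gaussPow b ρ n (X n) := by
  classical
  conv_lhs => rw [← DirectSum.sum_support_of X, map_sum]
  refine (Finset.sum_congr rfl fun n _ => gaussFunctional_inDeg b ρ n (X n)).trans
    (Finset.sum_subset (fun n hn => ?_) fun n _ hn => ?_)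
  · by_contra h
    exact DFinsupp.mem_support_iff.mp hn (hs n h)
  · rw [DFinsupp.notMem_support_iff.mp hn, map_zero]

theorem sum_half_pow_div_factorial_le (n m : ℕ) :
    ∑ j ∈ Finset.range m, ((n : ℝ) / 2) ^ j / j.factorial ≤ 2 ^ n := by
  have exp_half_le : Real.exp (1 / 2) ≤ 2 :=
    (Real.exp_bound_div_one_sub_of_interval (by norm_num) (by norm_num)).trans (by norm_num)
  calc ∑ j ∈ Finset.range m, ((n : ℝ) / 2) ^ j / j.factorial
      ≤ Real.exp (n / 2) := Real.sum_le_exp_of_nonneg (by positivity) m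
    _ = Real.exp (1 / 2) ^ n := by rw [← Real.exp_nat_mul]; ring_nf
    _ ≤ 2 ^ n := by gcongr

theorem pairing_count_sq_le {n j : ℕ} (h : 2 * j ≤ n) :
    (n.descFactorial (2 * j) / (2 ^ j * j.factorial) : ℝ) ^ 2 ≤
      (((n : ℝ) / 2) ^ j / j.factorial) ^ 2 * n.factorial := by
  have le_pow : (n.descFactorial (2 * j) : ℝ) ≤ (n ^ j) ^ 2 := by
    rw [← pow_mul, mul_comm j]
    exact_mod_cast Nat.descFactorial_le_pow n (2 * j)
  have le_factorial : (n.descFactorial (2 * j) : ℝ) ≤ n.factorial := by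
    rw [← Nat.factorial_mul_descFactorial h]
    exact_mod_cast Nat.le_mul_of_pos_left _ (Nat.factorial_pos _)
  calc (n.descFactorial (2 * j) / (2 ^ j * j.factorial) : ℝ) ^ 2
      = n.descFactorial (2 * j) * n.descFactorial (2 * j) / (2 ^ j * j.factorial) ^ 2 := by ring
    _ ≤ ((n : ℝ) ^ j) ^ 2 * n.factorial / (2 ^ j * j.factorial) ^ 2 := by gcongr
    _ = (((n : ℝ) / 2) ^ j / j.factorial) ^ 2 * n.factorial := by simp only [div_pow, mul_pow]; ring

variable {b : V →ₗ[ℂ] V →ₗ[ℂ] ℂ} {ρ : V →ₗ[ℂ] ℂ}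

theorem norm_gaussPow_le (hB : B.IsNonneg)
    (hρ : ∀ (d : ℕ) (x : Fin d → V), Matrix.vecMulVec (star fun i => ρ (x i))
      (fun i => ρ (x i)) ≤ Matrix.of fun i j => B (x i) (x j))
    (hb : ∀ (d : ℕ) (x y : Fin d → V), Matrix.vecMulVec (star fun i => b (x i) (y i))
      (fun i => b (x i) (y i)) ≤ Matrix.of fun i j => B (x i) (x j) * B (y i) (y j))
    (n : ℕ) (T : ⨂[ℂ]^n V) :
    ‖gaussPow b ρ n T‖ ≤ 2 ^ n * √(powForm B n T T).re := by
  have nonneg : 0 ≤ (powForm B n T T).re :=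
    (Complex.nonneg_iff.mp (powForm_nonneg B (conj_form_apply hB) hB.nonneg n T)).1
  have term_le (j : ℕ) (hj : j ∈ Finset.range (n / 2 + 1)) :
      ‖((n.descFactorial (2 * j) / (2 ^ j * j.factorial) : ℂ) •
        PiTensorProduct.lift (pairForm b ρ j n)) T‖ ≤
        (n / 2) ^ j / j.factorial * √(powForm B n T T).re := by
    have hj' : 2 * j ≤ n := by rw [Finset.mem_range] at hj; omega
    have lift_le := factorial_mul_norm_lift_sq_le
      (fun d x => vecMulVec_star_pairForm_le b ρ hB (hρ d) (hb d) j n x) T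
    rw [LinearMap.smul_apply, smul_eq_mul, norm_mul]
    refine le_of_sq_le_sq ?_ (by positivity)
    simp only [norm_div, norm_mul, norm_pow, Complex.norm_natCast, Complex.norm_ofNat]
    calc _ ≤ (((n : ℝ) / 2) ^ j / j.factorial) ^ 2 * n.factorial *
          ‖PiTensorProduct.lift (pairForm b ρ j n) T‖ ^ 2 := by
          rw [mul_pow]; gcongr; exact pairing_count_sq_le hj'
      _ ≤ (((n : ℝ) / 2) ^ j / j.factorial) ^ 2 * (powForm B n T T).re := by
          rw [mul_assoc]; gcongr
      _ = _ := by rw [mul_pow, Real.sq_sqrt nonneg]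
  calc ‖gaussPow b ρ n T‖
      ≤ ∑ j ∈ Finset.range (n / 2 + 1), (n / 2) ^ j / j.factorial * √(powForm B n T T).re := by
        rw [gaussPow, LinearMap.sum_apply]
        exact norm_sum_le_of_le _ term_le
    _ ≤ 2 ^ n * √(powForm B n T T).re := by
        rw [← Finset.sum_mul]
        gcongr
        exact sum_half_pow_div_factorial_le n _

variable [TopologicalSpace V]

theorem norm_gaussFunctional_le (α : PosHermForm V)
    (hρ : ∀ (d : ℕ) (x : Fin d → V), Matrix.vecMulVec (star fun i => ρ (x i))
      (fun i => ρ (x i)) ≤ Matrix.of fun i j => α.form (x i) (x j))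
    (hb : ∀ (d : ℕ) (x y : Fin d → V), Matrix.vecMulVec (star fun i => b (x i) (y i))
      (fun i => b (x i) (y i)) ≤ Matrix.of fun i j => α.form (x i) (x j) * α.form (y i) (y j))
    (X : TensorAlg V) :
    ‖gaussFunctional b ρ X‖ ≤ 2 * tensorSeminorm (α.scale 16) X := by
  classical
  have degree_le (n : ℕ) :
      2 ^ n * √(powForm α.form n (X n) (X n)).re ≤
        (1 / 2) ^ n * tensorSeminorm (α.scale 16) X := by
    have scaled : (powForm (α.scale 16).form n (X n) (X n)).re =
        (4 ^ n) ^ 2 * (powForm α.form n (X n) (X n)).re := by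
      change (powForm (((16 : NNReal) : ℂ) • α.form) n (X n) (X n)).re = _
      rw [powForm_smul_self, ← Complex.re_ofReal_mul]
      congr 2
      push_cast
      rw [← pow_mul, mul_comm n, pow_mul]
      norm_num
    have sqrt_le : 4 ^ n * √(powForm α.form n (X n) (X n)).re ≤
        tensorSeminorm (α.scale 16) X := by
      rw [← Real.sqrt_sq (by positivity : (0 : ℝ) ≤ 4 ^ n), ← Real.sqrt_mul (by positivity),
        ← scaled]
      exact Real.sqrt_le_sqrt
        (Complex.le_def.mp (powForm_le_tensorForm (α.scale 16).isNonneg X n)).1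
    calc (2 : ℝ) ^ n * √(powForm α.form n (X n) (X n)).re
        = (1 / 2) ^ n * (4 ^ n * √(powForm α.form n (X n) (X n)).re) := by
          rw [← mul_assoc, ← mul_pow]; norm_num
      _ ≤ (1 / 2) ^ n * tensorSeminorm (α.scale 16) X := by gcongr
  rw [gaussFunctional_eq_sum b ρ fun n => DFinsupp.notMem_support_iff.mp]
  calc ‖∑ n ∈ DFinsupp.support X, gaussPow b ρ n (X n)‖
      ≤ ∑ n ∈ DFinsupp.support X, (1 / 2) ^ n * tensorSeminorm (α.scale 16) X :=
        norm_sum_le_of_le _ fun n _ =>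
          (norm_gaussPow_le α.isNonneg hρ hb n (X n)).trans (degree_le n)
    _ ≤ 2 * tensorSeminorm (α.scale 16) X := by
        rw [← Finset.sum_mul]
        gcongr
        exact (summable_geometric_two.sum_le_tsum _ fun n _ => by positivity).trans
          tsum_geometric_two.le

theorem exists_continuous_gaussFunctional (hb : IsHilbertSchmidt b) (ρ : V →L[ℂ] ℂ) :
    ∃ ω : symTensors V →L[ℂ] ℂ, ∀ X, ω X = gaussFunctional b ρ.toLinearMap X := by
  obtain ⟨α, hα, hα_sum⟩ := hb
  simp only [α.seminorm_eq_zero_iff] at hα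
  set γ := α.add (PosHermForm.ofFunctional ρ)
  have form_le : (γ.form - α.form).IsNonneg := by
    rw [PosHermForm.add_form, add_sub_cancel_left]
    exact (PosHermForm.ofFunctional ρ).isNonneg
  have rankOne_le : (γ.form - (PosHermForm.ofFunctional ρ).form).IsNonneg := by
    rw [PosHermForm.add_form, add_sub_cancel_right]
    exact α.isNonneg
  have mean_le (d : ℕ) (x : Fin d → V) : Matrix.vecMulVec (star fun i => ρ (x i))
      (fun i => ρ (x i)) ≤ Matrix.of fun i j => γ.form (x i) (x j) :=
    gram_mono rankOne_le x
  have covariance_le (d : ℕ) (x y : Fin d → V) :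
      Matrix.vecMulVec (star fun i => b (x i) (y i)) (fun i => b (x i) (y i)) ≤
        Matrix.of fun i j => γ.form (x i) (x j) * γ.form (y i) (y j) :=
    (vecMulVec_star_le_of_hilbertSchmidt α.isNonneg hα hα_sum x y).trans
      (hadamard_le_hadamard (gram_nonneg α.isNonneg x) (gram_mono form_le x)
        (gram_nonneg α.isNonneg y) (gram_mono form_le y))
  have cont : Continuous (gaussFunctional b ρ.toLinearMap) :=
    WithSeminorms.continuous_normedSpace_rng (E := TensorAlg V) ℂ
      (tensorAlg_withSeminorms (V := V)) (gaussFunctional b ρ.toLinearMap)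
      ⟨{γ.scale 16}, 2, fun X => by
        rw [Finset.sup_singleton]
        exact norm_gaussFunctional_le γ mean_le covariance_le X⟩
  exact ⟨⟨gaussFunctional b ρ.toLinearMap ∘ₗ (symTensors V).subtype,
    cont.comp continuous_subtype_val⟩, fun _ => rfl⟩

end Bound

section Positivity

open PowerSeries
open scoped MatrixOrder Matrix

theorem mixCoeff_eq_sum_range (G H : ℂ⟦X⟧) (c : ℂ) {p q N : ℕ} (hN : min p q < N) :
    mixCoeff G H c p q =
      ∑ s ∈ Finset.range N, c ^ s / s.factorial * (coeff p (X ^ s * G) * coeff q (X ^ s * H)) := by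
  rw [mixCoeff]
  refine Finset.sum_subset_zero_on_sdiff (Finset.range_subset_range.mpr hN) (fun s hs => ?_)
    fun s hs => ?_
  · have : min p q < s := by
      by_contra! h
      exact (Finset.mem_sdiff.mp hs).2 (Finset.mem_range.mpr (Nat.lt_succ_of_le h))
    rw [coeff_X_pow_mul', coeff_X_pow_mul']
    rcases min_lt_iff.mp this with h | h <;> simp [h.not_ge]
  · have : s ≤ min p q := Nat.lt_succ_iff.mp (Finset.mem_range.mp hs)
    rw [coeff_X_pow_mul', coeff_X_pow_mul', if_pos (le_min_iff.mp this).1,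
      if_pos (le_min_iff.mp this).2]

theorem mixCoeff_kernel_nonneg {ι : Type*} [Finite ι] {A : Matrix ι ι ℂ} (hA : 0 ≤ A)
    (G : ι → ℂ⟦X⟧) (k : ι → ℕ) :
    0 ≤ Matrix.of fun i j =>
      mixCoeff (PowerSeries.map (starRingEnd ℂ) (G i)) (G j) (A i j) (k i) (k j) := by
  obtain ⟨N, hN⟩ := (Set.finite_range k).bddAbove
  let u (s : ℕ) (i : ι) : ℂ := coeff (k i) (X ^ s * G i)
  have expand : (Matrix.of fun i j =>
      mixCoeff (PowerSeries.map (starRingEnd ℂ) (G i)) (G j) (A i j) (k i) (k j)) =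
        ∑ s ∈ Finset.range (N + 1), (s.factorial : ℂ)⁻¹ •
          (Matrix.of (fun i j => A i j ^ s) ⊙ Matrix.vecMulVec (star (u s)) (u s)) := by
    ext i j
    have bound : min (k i) (k j) < N + 1 :=
      (min_le_left _ _).trans_lt (Nat.lt_succ_of_le (hN ⟨i, rfl⟩))
    have conj_u (s : ℕ) :
        coeff (k i) (X ^ s * PowerSeries.map (starRingEnd ℂ) (G i)) = conj (u s i) := by
      rw [← coeff_map, map_mul (PowerSeries.map _), map_pow (PowerSeries.map _), PowerSeries.map_X]
    rw [Matrix.of_apply, mixCoeff_eq_sum_range _ _ _ bound, Matrix.sum_apply]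
    refine Finset.sum_congr rfl fun s _ => ?_
    rw [conj_u, Matrix.smul_apply, Matrix.hadamard_apply, Matrix.of_apply, Matrix.vecMulVec_apply,
      smul_eq_mul, div_eq_inv_mul, mul_assoc]
    rfl
  rw [expand, Matrix.nonneg_iff_posSemidef]
  refine Matrix.posSemidef_sum _ fun s _ => Matrix.PosSemidef.smul ?_ (by positivity)
  exact (Matrix.nonneg_iff_posSemidef.mp (entrywise_pow_nonneg hA s)).hadamard
    (Matrix.posSemidef_vecMulVec_star_self _)

variable {V : Type*} [AddCommGroup V] [Module ℂ V]

theorem gaussFunctional_mulStar_tensorStar_nonneg {b : V →ₗ[ℂ] V →ₗ[ℂ] ℂ} {ρ : V →ₗ[ℂ] ℂ}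
    {c : V →ₗ⋆[ℂ] V} {Λ : V →ₗ[ℂ] V →ₗ[ℂ] ℂ} (hb : ∀ v w, b v w = b w v)
    (hbc : ∀ v, b (c v) (c v) = conj (b v v)) (hρ : ∀ v, ρ (c v) = conj (ρ v))
    (hpos : ((Λ + b).comp c).IsNonneg) (X : symTensors V) :
    0 ≤ gaussFunctional b ρ (mulStar Λ (tensorStar c X ⊗ₜ X)) := by
  obtain ⟨n, a, v, k, hX⟩ := exists_eq_sum_divPow X
  have star_coeff (v : V) : gaussSeries (ρ (c v)) (b (c v) (c v)) =
      PowerSeries.map (starRingEnd ℂ) (gaussSeries (ρ v) (b v v)) := by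
    ext n
    rw [coeff_map, conj_coeff_gaussSeries, hρ, hbc]
  have kernel := mixCoeff_kernel_nonneg (gram_nonneg hpos v)
    (fun i => gaussSeries (ρ (v i)) (b (v i) (v i))) k
  have expand : gaussFunctional b ρ (mulStar Λ (tensorStar c X ⊗ₜ X)) =
      star a ⬝ᵥ (Matrix.of fun i j => mixCoeff
        (PowerSeries.map (starRingEnd ℂ) (gaussSeries (ρ (v i)) (b (v i) (v i))))
        (gaussSeries (ρ (v j)) (b (v j) (v j))) (((Λ + b).comp c) (v i) (v j)) (k i) (k j)) *ᵥ
          a := by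
    simp only [hX, map_sum, map_smulₛₗ, tensorStar_divPow, TensorProduct.sum_tmul,
      TensorProduct.tmul_sum, TensorProduct.tmul_smul, ← TensorProduct.smul_tmul',
      gaussFunctional_mulStar_divPow ρ hb, star_coeff, dotProduct, Matrix.mulVec,
      Finset.mul_sum, Matrix.of_apply, smul_eq_mul]
    rw [Finset.sum_comm]
    refine Finset.sum_congr rfl fun i _ => Finset.sum_congr rfl fun j _ => ?_
    simp only [RingHom.id_apply, Pi.star_apply, starRingEnd_apply, LinearMap.comp_apply,
      LinearMap.add_apply]
    ring
  rw [expand]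
  exact (Matrix.nonneg_iff_posSemidef.mp kernel).dotProduct_mulVec_nonneg a

end Positivity

section Separation

open PiTensorProduct (dualDistrib tprod)

theorem sum_filter_eq_zero_of_forall_real {κ : Type*} {S : Finset κ} {e : κ → ℕ} {d : κ → ℂ}
    (h : ∀ s : ℝ, ∑ i ∈ S, (s : ℂ) ^ e i * d i = 0) (N : ℕ) :
    ∑ i ∈ S with e i = N, d i = 0 := by
  let Q : Polynomial ℂ := ∑ i ∈ S, Polynomial.monomial (e i) (d i)
  have Q_eq_zero : Q = 0 := by
    refine Polynomial.eq_zero_of_infinite_isRoot Q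
      ((Set.infinite_range_of_injective Complex.ofReal_injective).mono ?_)
    rintro _ ⟨s, rfl⟩
    simp only [Set.mem_ofPred_eq, Polynomial.IsRoot, Q, Polynomial.eval_finsetSum,
      Polynomial.eval_monomial, ← h s, mul_comm]
  have coeff_Q : Q.coeff N = ∑ i ∈ S with e i = N, d i := by
    simp only [Q, Polynomial.finsetSum_coeff, Polynomial.coeff_monomial, Finset.sum_filter]
  rw [← coeff_Q, Q_eq_zero, Polynomial.coeff_zero]

variable {V : Type*} [AddCommGroup V] [Module ℂ V]

theorem pairForm_smul (b : V →ₗ[ℂ] V →ₗ[ℂ] ℂ) (ρ : V →ₗ[ℂ] ℂ) (s : ℂ) {j n : ℕ}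
    (h : 2 * j ≤ n) : pairForm b (s • ρ) j n = s ^ (n - 2 * j) • pairForm b ρ j n := by
  obtain ⟨p, rfl⟩ := Nat.exists_eq_add_of_le' h
  rw [Nat.add_sub_cancel]
  induction j with
  | zero => ext x; simp [pairForm_zero, Finset.prod_mul_distrib]
  | succ j ih =>
    ext x
    change pairForm b (s • ρ) (j + 1) (p + 2 * j + 2) x =
      s ^ p * pairForm b ρ (j + 1) (p + 2 * j + 2) x
    rw [pairForm_succ, pairForm_succ, ih (Nat.le_add_left _ _), smul_apply, smul_eq_mul]
    ring

theorem gaussPow_smul (b : V →ₗ[ℂ] V →ₗ[ℂ] ℂ) (ρ : V →ₗ[ℂ] ℂ) (s : ℂ) (n : ℕ)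
    (T : ⨂[ℂ]^n V) :
    gaussPow b (s • ρ) n T = ∑ j ∈ Finset.range (n / 2 + 1), s ^ (n - 2 * j) *
      (n.descFactorial (2 * j) / (2 ^ j * j.factorial) *
        PiTensorProduct.lift (pairForm b ρ j n) T) := by
  rw [gaussPow, LinearMap.sum_apply]
  refine Finset.sum_congr rfl fun j hj => ?_
  have hj' : 2 * j ≤ n := by rw [Finset.mem_range] at hj; omega
  rw [pairForm_smul b ρ s hj', map_smul, LinearMap.smul_apply, LinearMap.smul_apply, smul_eq_mul,
    smul_eq_mul, mul_left_comm]

theorem lift_pairForm_zero (b : V →ₗ[ℂ] V →ₗ[ℂ] ℂ) (ρ : V →ₗ[ℂ] ℂ) (n : ℕ) :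
    PiTensorProduct.lift (pairForm b ρ 0 n) = dualDistrib (tprod ℂ fun _ : Fin n => ρ) := by
  ext x
  simp [pairForm_zero]

theorem dualDistrib_const_eq_zero_of_gaussFunctional {b : V →ₗ[ℂ] V →ₗ[ℂ] ℂ} {ρ : V →ₗ[ℂ] ℂ}
    {X : TensorAlg V} (h : ∀ s : ℝ, gaussFunctional b ((s : ℂ) • ρ) X = 0) {N : ℕ}
    (hN : ∀ n, N < n → X n = 0) : dualDistrib (tprod ℂ fun _ : Fin N => ρ) (X N) = 0 := by
  let S := (Finset.range (N + 1)).sigma fun n => Finset.range (n / 2 + 1)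
  let d (p : Σ _ : ℕ, ℕ) : ℂ := p.1.descFactorial (2 * p.2) / (2 ^ p.2 * p.2.factorial) *
    PiTensorProduct.lift (pairForm b ρ p.2 p.1) (X p.1)
  have vanish (s : ℝ) : ∑ p ∈ S, (s : ℂ) ^ (p.1 - 2 * p.2) * d p = 0 := by
    rw [← h s, gaussFunctional_eq_sum b _ (s := Finset.range (N + 1)) fun n hn => hN n ?_,
      Finset.sum_sigma]
    · simp only [gaussPow_smul, d]
    · simpa using hn
  have leading : {p ∈ S | p.1 - 2 * p.2 = N} = {⟨N, 0⟩} := by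
    ext ⟨n, j⟩
    simp only [S, Finset.mem_filter, Finset.mem_sigma, Finset.mem_range, Finset.mem_singleton,
      Sigma.mk.injEq, heq_eq_eq]
    omega
  have := sum_filter_eq_zero_of_forall_real vanish N
  rw [leading, Finset.sum_singleton] at this
  simpa [d, lift_pairForm_zero] using this

theorem dualDistrib_powSym {n : ℕ} (f : Fin n → Module.Dual ℂ V) (T : ⨂[ℂ]^n V) :
    dualDistrib (tprod ℂ f) (powSym n T) =
      (n.factorial : ℂ)⁻¹ * ∑ σ : Equiv.Perm (Fin n), dualDistrib (tprod ℂ fun i => f (σ i)) T := by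
  suffices dualDistrib (tprod ℂ f) ∘ₗ powSym n =
      (n.factorial : ℂ)⁻¹ • ∑ σ : Equiv.Perm (Fin n), dualDistrib (tprod ℂ fun i => f (σ i)) by
    simpa using LinearMap.congr_fun this T
  ext x
  simp only [LinearMap.compMultilinearMap_apply, LinearMap.comp_apply, powSym_tprod, map_smul,
    map_sum, LinearMap.smul_apply, LinearMap.sum_apply, PiTensorProduct.dualDistrib_apply]
  congr 1
  refine Fintype.sum_equiv (Equiv.inv _) _ _ fun σ => ?_
  rw [← Equiv.prod_comp σ fun m => f ((Equiv.inv _ σ) m) (x m)]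
  simp

theorem exists_finiteDimensional_map_subtype {n : ℕ} (T : ⨂[ℂ]^n V) :
    ∃ W : Submodule ℂ V, FiniteDimensional ℂ W ∧
      ∃ T' : ⨂[ℂ]^n W, PiTensorProduct.map (fun _ => W.subtype) T' = T := by
  obtain ⟨d, a, x, rfl⟩ := exists_eq_sum_tprod T
  let W := Submodule.span ℂ (Set.range (Function.uncurry x))
  have mem (i : Fin d) (m : Fin n) : x i m ∈ W := Submodule.subset_span ⟨(i, m), rfl⟩
  refine ⟨W, FiniteDimensional.span_of_finite ℂ (Set.finite_range _),
    ∑ i, a i • tprod ℂ fun m => ⟨x i m, mem i m⟩, ?_⟩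
  simp [PiTensorProduct.map_tprod]

variable [TopologicalSpace V]

theorem eq_zero_of_dualDistrib [SeparatingDual ℂ V] {n : ℕ} {T : ⨂[ℂ]^n V}
    (h : ∀ f : Fin n → V →L[ℂ] ℂ, dualDistrib (tprod ℂ fun m => (f m).toLinearMap) T = 0) :
    T = 0 := by
  obtain ⟨W, _, T, rfl⟩ := exists_finiteDimensional_map_subtype T
  let e := Module.finBasis ℂ W
  have surj := (SeparatingDual.dualMap_surjective_iff (R := ℂ) (f := W.subtype)).mpr
    W.injective_subtype
  choose F hF using fun i => surj (e.coord i)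
  suffices T = 0 by rw [this, map_zero]
  refine (Basis.piTensorProduct fun _ => e).ext_elem fun I => ?_
  have coord : (Basis.piTensorProduct fun _ => e).coord I =
      dualDistrib (tprod ℂ fun m => (F (I m)).toLinearMap) ∘ₗ
        PiTensorProduct.map fun _ => W.subtype := by
    ext x
    simpa [Basis.piTensorProduct_repr_tprod_apply, PiTensorProduct.map_tprod] using
      Finset.prod_congr rfl fun m _ => (LinearMap.congr_fun (hF (I m)) (x m)).symm
  rw [map_zero, Finsupp.zero_apply, ← Module.Basis.coord_apply, coord, LinearMap.comp_apply, h]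

theorem eq_zero_of_dualDistrib_const [SeparatingDual ℂ V] {S : AddSubmonoid (V →L[ℂ] ℂ)}
    (hS : Submodule.span ℂ (S : Set (V →L[ℂ] ℂ)) = ⊤) {n : ℕ} {T : ⨂[ℂ]^n V}
    (hT : powSym n T = T)
    (h : ∀ ρ ∈ S, dualDistrib (tprod ℂ fun _ : Fin n => ρ.toLinearMap) T = 0) : T = 0 := by
  let Φ : MultilinearMap ℂ (fun _ : Fin n => V →L[ℂ] ℂ) ℂ :=
    (LinearMap.applyₗ T ∘ₗ dualDistrib).compMultilinearMap
      ((PiTensorProduct.tprod ℂ).compLinearMap fun _ => ContinuousLinearMap.coeLM ℂ)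
  have Φ_eq_zero : Φ = 0 := by
    refine MultilinearMap.ext_of_span_eq_top (g := fun _ (ρ : S) => (ρ : V →L[ℂ] ℂ))
      (fun _ => by simpa using hS) fun f => ?_
    have polarized := sum_neg_one_pow_card_smul_map_sum Φ fun i => (f i : V →L[ℂ] ℂ)
    rw [Finset.sum_eq_zero fun s _ => ?_] at polarized
    · have symmetrized := dualDistrib_powSym (fun i => (f i : V →L[ℂ] ℂ).toLinearMap) T
      rw [hT] at symmetrized
      exact symmetrized.trans (mul_eq_zero_of_right _ polarized.symm)
    · exact smul_eq_zero_of_right _ (h _ (sum_mem fun i _ => (f i).2))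
  exact eq_zero_of_dualDistrib fun f => DFunLike.congr_fun Φ_eq_zero f

/-- The continuous linear functionals that are Hermitian with respect to the conjugation `c`. -/
def hermitianDual (c : V →L⋆[ℂ] V) : Submodule ℝ (V →L[ℂ] ℂ) where
  carrier := {ρ | ∀ v, ρ (c v) = conj (ρ v)}
  add_mem' hρ hσ v := by simp [hρ v, hσ v]
  zero_mem' v := by simp
  smul_mem' s ρ hρ v := by simp [hρ v]

theorem span_hermitianDual {c : V →L⋆[ℂ] V} (hc : ∀ v, c (c v) = v) :
    Submodule.span ℂ (hermitianDual c : Set (V →L[ℂ] ℂ)) = ⊤ := by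
  refine eq_top_iff.mpr fun ρ _ => ?_
  let ρ' : V →L[ℂ] ℂ := ((starL ℂ : ℂ ≃L⋆[ℂ] ℂ) : ℂ →L⋆[ℂ] ℂ).comp (ρ.comp c)
  have real_part : (2 : ℂ)⁻¹ • (ρ + ρ') ∈ hermitianDual c := fun v => by
    simp [ρ', hc, add_comm, Complex.conj_ofNat]
  have imaginary_part : (2 * Complex.I)⁻¹ • (ρ - ρ') ∈ hermitianDual c := fun v => by
    simp only [ρ', hc, mul_inv_rev, Complex.inv_I, neg_mul, smul_apply, sub_apply,
      ContinuousLinearMap.comp_apply, ContinuousLinearEquiv.coe_coe, starL_apply, RCLike.star_def,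
      smul_eq_mul, map_neg, map_mul, Complex.conj_I, map_inv₀, Complex.conj_ofNat, map_sub,
      Complex.conj_conj]
    ring
  have decomposition : ρ = (2 : ℂ)⁻¹ • (ρ + ρ') + Complex.I • (2 * Complex.I)⁻¹ • (ρ - ρ') := by
    rw [smul_smul, mul_inv, mul_left_comm, mul_inv_cancel₀ Complex.I_ne_zero]
    module
  rw [decomposition]
  exact add_mem (Submodule.subset_span real_part)
    (Submodule.smul_mem _ _ (Submodule.subset_span imaginary_part))

theorem eq_zero_of_gaussFunctional [SeparatingDual ℂ V] {c : V →L⋆[ℂ] V} (hc : ∀ v, c (c v) = v)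
    (b : V →ₗ[ℂ] V →ₗ[ℂ] ℂ) {X : symTensors V}
    (h : ∀ ρ ∈ hermitianDual c, gaussFunctional b ρ.toLinearMap X = 0) : X = 0 := by
  classical
  by_contra hX
  have nonempty : (DFinsupp.support (X : TensorAlg V)).Nonempty :=
    Finset.nonempty_iff_ne_empty.mpr fun h0 => hX (Subtype.ext (DFinsupp.support_eq_empty.mp h0))
  obtain ⟨N, hN, le_N⟩ := Finset.exists_max_image _ id nonempty
  refine DFinsupp.mem_support_iff.mp hN (eq_zero_of_dualDistrib_const
    (S := (hermitianDual c).toAddSubmonoid) (span_hermitianDual hc)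
    (congrArg (fun Y : TensorAlg V => Y N) (sym_of_mem X.2)) fun ρ hρ =>
      dualDistrib_const_eq_zero_of_gaussFunctional (b := b) (fun s => ?_) fun n hn => ?_)
  · exact h ((s : ℂ) • ρ) ((hermitianDual c).smul_mem s hρ)
  · by_contra h0
    exact (le_N n (DFinsupp.mem_support_iff.mpr h0)).not_gt hn

end Separation

section Main

variable {V : Type*} [AddCommGroup V] [Module ℂ V] [TopologicalSpace V] {c : V →L⋆[ℂ] V}
  {Λ b : V →ₗ[ℂ] V →ₗ[ℂ] ℂ}

theorem exists_isPositive_eq_gaussFunctional (hc : ∀ v, c (c v) = v) (hb : ∀ v w, b v w = b w v)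
    (hbc : IsHermitian c b) (hHS : IsHilbertSchmidt b) (hpos : ∀ v, 0 ≤ Λ (c v) v + b (c v) v)
    {ρ : V →L[ℂ] ℂ} (hρ : ρ ∈ hermitianDual c) :
    ∃ ω : symTensors V →L[ℂ] ℂ, IsPositive c Λ ω ∧
      ∀ X, ω X = gaussFunctional b ρ.toLinearMap X := by
  obtain ⟨ω, hω⟩ := exists_continuous_gaussFunctional hHS ρ
  refine ⟨ω, fun X => ?_, hω⟩
  rw [hω, starProd_coe]
  have diagonal (v : V) : b (c v) (c v) = conj (b v v) := by rw [hbc, hc]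
  exact gaussFunctional_mulStar_tensorStar_nonneg hb diagonal hρ ⟨hpos⟩ X

theorem exists_isPositive_ne_zero_iff (hc : ∀ v, c (c v) = v) :
    (∃ ω : symTensors V →L[ℂ] ℂ, ω ≠ 0 ∧ IsPositive c Λ ω) ↔
      ∃ b : V →ₗ[ℂ] V →ₗ[ℂ] ℂ, (∀ v w, b v w = b w v) ∧ IsHermitian c b ∧
        IsHilbertSchmidt b ∧ ∀ v, 0 ≤ Λ (c v) v + b (c v) v := by
  refine ⟨fun ⟨ω, ω_ne_zero, hω⟩ => hω.exists_hilbertSchmidt hc ω_ne_zero,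
    fun ⟨b, hb, hbc, hHS, hpos⟩ => ?_⟩
  obtain ⟨ω, hω, ω_eq⟩ := exists_isPositive_eq_gaussFunctional hc hb hbc hHS hpos (zero_mem _)
  refine ⟨ω, fun ω_eq_zero => ?_, hω⟩
  have ω_one : ω symOne = 1 := by
    simp [ω_eq, symOne, ← divPow_zero (0 : V), gaussFunctional_divPow, coeff_gaussSeries]
  simp [ω_eq_zero] at ω_one

theorem eq_zero_of_forall_isPositive [SeparatingDual ℂ V] (hc : ∀ v, c (c v) = v)
    (h : ∃ ω : symTensors V →L[ℂ] ℂ, ω ≠ 0 ∧ IsPositive c Λ ω) {X : symTensors V}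
    (hX : ∀ ω : symTensors V →L[ℂ] ℂ, IsPositive c Λ ω → ω X = 0) : X = 0 := by
  obtain ⟨b, hb, hbc, hHS, hpos⟩ := (exists_isPositive_ne_zero_iff hc).mp h
  refine eq_zero_of_gaussFunctional hc b fun ρ hρ => ?_
  obtain ⟨ω, hω, ω_eq⟩ := exists_isPositive_eq_gaussFunctional hc hb hbc hHS hpos hρ
  rw [← ω_eq, hX ω hω]

theorem separatingDual_of_locallyConvexSpace (E : Type*) [AddCommGroup E] [Module ℂ E]
    [TopologicalSpace E] [IsTopologicalAddGroup E] [ContinuousSMul ℂ E] [LocallyConvexSpace ℝ E]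
    [T1Space E] : SeparatingDual ℂ E where
  exists_ne_zero' x hx := by
    obtain ⟨f, hf⟩ := RCLike.geometric_hahn_banach_point_point (𝕜 := ℂ) hx
    exact ⟨f, fun h => by simp [h] at hf⟩

end Main

end

end HilbertStar

theorem theorem3p25_general {V : Type*} [AddCommGroup V] [Module ℂ V] [TopologicalSpace V]
    [SeparatingDual ℂ V] (c : V →L⋆[ℂ] V) (hc : ∀ v, c (c v) = v) (Λ : V →ₗ[ℂ] V →ₗ[ℂ] ℂ) :
    ((∃ ω : HilbertStar.symTensors V →L[ℂ] ℂ, ω ≠ 0 ∧ HilbertStar.IsPositive c Λ ω) ↔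
      ∃ b : V →ₗ[ℂ] V →ₗ[ℂ] ℂ, (∀ v w, b v w = b w v) ∧ HilbertStar.IsHermitian c b ∧
        HilbertStar.IsHilbertSchmidt b ∧ ∀ v, 0 ≤ Λ (c v) v + b (c v) v) ∧
    ((∃ ω : HilbertStar.symTensors V →L[ℂ] ℂ, ω ≠ 0 ∧ HilbertStar.IsPositive c Λ ω) →
      ∀ X : HilbertStar.symTensors V,
        (∀ ω : HilbertStar.symTensors V →L[ℂ] ℂ, HilbertStar.IsPositive c Λ ω → ω X = 0) →
          X = 0) :=
  ⟨HilbertStar.exists_isPositive_ne_zero_iff hc,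
    fun h _ => HilbertStar.eq_zero_of_forall_isPositive hc h⟩

theorem theorem3p25 {V : Type*} [AddCommGroup V] [Module ℂ V] [TopologicalSpace V]
    [IsTopologicalAddGroup V] [ContinuousSMul ℂ V] [LocallyConvexSpace ℝ V] [T2Space V]
    [Nontrivial V] (hV : HilbertStar.IsHilbertisable V)
    (c : V →L⋆[ℂ] V) (hc : ∀ v, c (c v) = v)
    (Λ : V →ₗ[ℂ] V →ₗ[ℂ] ℂ) (hΛcont : Continuous fun p : V × V => Λ p.1 p.2)
    (hΛ : HilbertStar.IsHermitian c Λ) :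
    ((∃ ω : HilbertStar.symTensors V →L[ℂ] ℂ, ω ≠ 0 ∧ HilbertStar.IsPositive c Λ ω) ↔
      ∃ b : V →ₗ[ℂ] V →ₗ[ℂ] ℂ, (∀ v w, b v w = b w v) ∧ HilbertStar.IsHermitian c b ∧
        HilbertStar.IsHilbertSchmidt b ∧ ∀ v, 0 ≤ Λ (c v) v + b (c v) v) ∧
    ((∃ ω : HilbertStar.symTensors V →L[ℂ] ℂ, ω ≠ 0 ∧ HilbertStar.IsPositive c Λ ω) →
      ∀ X : HilbertStar.symTensors V,
        (∀ ω : HilbertStar.symTensors V →L[ℂ] ℂ, HilbertStar.IsPositive c Λ ω → ω X = 0) →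
          X = 0) := by
  have := HilbertStar.separatingDual_of_locallyConvexSpace V
  exact theorem3p25_general c hc Λ
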